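/- A multiring is a set $A$ with a commutative monoid structure $(A,\cdot,1)$, an element $0$, a map $-\colon A\to A$ and a multivalued sum $+\colon A\times A\to\mathcal P(A)\setminus\{\emptyset\}$ such that for all $a,b,c,d,g,x\in A$: (i) $a\in b+c$ implies $c\in -b+a$ and $b\in a+(-c)$; (ii) $a\in b+0$ iff $a=b$; (iii) if $x\in g+c$ with $g\in a+b$, then $x\in a+h$ for some $h\in b+c$; (iv) $a+b=b+a$; (v) $a\cdot 0=0$; (vi) $a\in b+c$ implies $ad\in bd+cd$. A morphism is a map preserving $\cdot,-,0,1$ with $f(a)\in f(b)+f(c)$ whenever $a\in b+c$; $\mathbf{Multi}$ is the resulting category. $A$ is a hyperring if every $x\in bd+cd$ has the form $x=ad$ with $a\in b+c$, and a von Neumann hyperring if moreover for every $a$ there is $b$ with $a=a^2b$. An ideal is a subset containing $0$ and closed under sums and under multiplication by $A$; prime ideals (proper, $ab\in p\Rightarrow a\in p$ or $b\in p$) form $\operatorname{spec}(A)$, with the topology generated by the sets $D(a)=\{p: a\notin p\}$. For a multiplicative set $S$, $S^{-1}A$ is the multiring of fractions, in which $a/s\in b/t+c/u$ iff $atuv\in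 bsuv+cstv$ for some $v\in S$. Let $S_a=\{x: a^n\in(x)\text{ for some }n\ge 0\}$, where $(x)$ is the ideal generated by $x$. The structural presheaf on basic open sets is $D(a)\mapsto S_a^{-1}A$ with the canonical restriction maps. $A$ is geometric if this is a sheaf of multirings, i.e. for every cover $D(e)=\bigcup_i D(e_i)$: if $x,y,z\in S_e^{-1}A$ satisfy $x\in y+z$ after restriction to every $D(e_i)$, then $x\in y+z$; and sections over the $D(e_i)$ which agree on all $D(e_ie_j)$ come from a section over $D(e)$. $\mathbf{GvNH}\subseteq\mathbf{Multi}$ is the full subcategory of geometric von Neumann hyperrings. For $p\in\operatorname{spec}(A)$ let $A/p$ be the quotient multiring (in which $a\sim b$ iff $(a-b)\cap p\neq\emptyset$, and $\bar a\in\bar b+\bar c$ iff this holds for some representatives) and let $K_A(p)$ be its hyperfield of fractions $(A/p\setminus\{0\})^{-1}(A/p)$. Let $V(A)$ be the set of families $f=(f(p))_p$, $f(p)\in K_A(p)$, such that every $p$ lies in a set $U$, clopen for the constructible topology of $\operatorname{spec}(A)$, for which there are $x,y\in A$ with $U\subseteq D(y)$ and $f(q)=x/y$ in $K_A(q)$ for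 all $q\in U$. Equip $V(A)$ with the pointwise product, negation, $0$, $1$ and with the sum given by $f\in g+h$ iff $f(p)\in g(p)+h(p)$ for all $p$. Let $v_A\colon A\to V(A)$ be the morphism $v_A(a)(p)=a/1$. **Theorem.** For every multiring $A$, $V(A)$ is a geometric von Neumann hyperring. Moreover, for all multirings $A,B$: 1. For every morphism $f\colon A\to B$ there is a unique morphism $V(f)\colon V(A)\to V(B)$ with $V(f)\circ v_A=v_B\circ f$; with these maps $V\colon\mathbf{Multi}\to\mathbf{GvNH}$ is a functor. 2. If $B$ is a geometric von Neumann hyperring, then for every morphism $f\colon A\to B$ there is a unique morphism $\bar f\colon V(A)\to B$ with $\bar f\circ v_A=f$. In other words, the functor $V$ is left adjoint to the inclusion $\mathbf{GvNH}\to\mathbf{Multi}$, with unit $v$. -/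

import Mathlib

universe u w

/-! ### Multirings -/

/-- The operations of a multiring: a commutative monoid with an absorbing zero, a map `a ↦ -a`,
and a multivalued sum. -/
class MultiringOps (A : Type u) extends CommMonoidWithZero A, Neg A where
  hadd : A → A → Set A

infixl:65 " +ₕ " => MultiringOps.hadd

/-- The axioms of a multiring (those on the product alone are part of `MultiringOps`). -/
class IsMultiring (A : Type u) [MultiringOps A] : Prop where
  nonempty (a b : A) : (a +ₕ b).Nonempty
  rev_left {a b c : A} : a ∈ b +ₕ c → c ∈ -b +ₕ a
  rev_right {a b c : A} : a ∈ b +ₕ c → b ∈ a +ₕ -c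
  mem_add_zero {a b : A} : a ∈ b +ₕ 0 ↔ a = b
  assoc {a b c g x : A} : x ∈ g +ₕ c → g ∈ a +ₕ b → ∃ h ∈ b +ₕ c, x ∈ a +ₕ h
  comm (a b : A) : a +ₕ b = b +ₕ a
  mul_mem {a b c : A} (d : A) : a ∈ b +ₕ c → a * d ∈ b * d +ₕ c * d

/-- Morphisms of multirings. -/
@[ext]
structure MultiringHom (A : Type u) (B : Type w) [MultiringOps A] [MultiringOps B] where
  toFun : A → B
  map_hadd {a b c : A} : a ∈ b +ₕ c → toFun a ∈ toFun b +ₕ toFun c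
  map_mul (a b : A) : toFun (a * b) = toFun a * toFun b
  map_zero : toFun 0 = 0
  map_one : toFun 1 = 1
  map_neg (a : A) : toFun (-a) = -toFun a

namespace MultiringHom

/-- The identity morphism. -/
def id (A : Type u) [MultiringOps A] : MultiringHom A A where
  toFun a := a
  map_hadd h := h
  map_mul _ _ := rfl
  map_zero := rfl
  map_one := rfl
  map_neg _ := rfl

/-- Composition: `g.comp f` is `g` after `f`. -/
def comp {A B C : Type*} [MultiringOps A] [MultiringOps B] [MultiringOps C]
    (g : MultiringHom B C) (f : MultiringHom A B) : MultiringHom A C where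
  toFun a := g.toFun (f.toFun a)
  map_hadd h := g.map_hadd (f.map_hadd h)
  map_mul a b := by rw [f.map_mul, g.map_mul]
  map_zero := by rw [f.map_zero, g.map_zero]
  map_one := by rw [f.map_one, g.map_one]
  map_neg a := by rw [f.map_neg, g.map_neg]

end MultiringHom

namespace IsMultiring

variable {A : Type u} [MultiringOps A] [IsMultiring A]

lemma self_mem (a : A) : a ∈ a +ₕ 0 := mem_add_zero.2 rfl

lemma mem_zero_add {a b : A} : a ∈ 0 +ₕ b ↔ a = b := by
  rw [comm, mem_add_zero]

lemma neg_zero : (-0 : A) = 0 := (mem_add_zero.1 (rev_left (self_mem (0 : A)))).symm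

lemma zero_mem (a : A) : (0 : A) ∈ a +ₕ -a := by
  have := rev_left (self_mem a)
  rwa [comm] at this

lemma neg_neg (a : A) : - -a = a := by
  have h := rev_left (zero_mem (-a))
  rw [mem_add_zero] at h
  have h2 := rev_left (zero_mem a)
  rw [mem_add_zero] at h2
  have h3 := rev_right (zero_mem a)
  rw [mem_zero_add] at h3
  exact h3.symm

lemma neg_mul (a b : A) : -a * b = -(a * b) := by
  have h := mul_mem b (zero_mem a)
  rw [zero_mul] at h
  exact mem_add_zero.1 (rev_left h)

lemma neg_mem {a b c : A} (h : a ∈ b +ₕ c) : -a ∈ -b +ₕ -c := by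
  have h1 := mul_mem (-1 : A) h
  have e : ∀ x : A, x * -1 = -x := fun x => by rw [mul_comm, neg_mul, one_mul]
  rwa [e, e, e] at h1

end IsMultiring

/-! ### Ideals -/

/-- Ideals of a multiring. -/
@[ext]
structure MIdeal (A : Type u) [MultiringOps A] where
  carrier : Set A
  zero_mem : (0 : A) ∈ carrier
  add_mem {a b c : A} : a ∈ carrier → b ∈ carrier → c ∈ a +ₕ b → c ∈ carrier
  mul_mem (a : A) {b : A} : b ∈ carrier → a * b ∈ carrier

/-- The set of prime ideals of a multiring. -/
@[ext]
structure MSpec (A : Type u) [MultiringOps A] extends MIdeal A where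
  one_notMem : (1 : A) ∉ carrier
  mem_or_mem {a b : A} : a * b ∈ carrier → a ∈ carrier ∨ b ∈ carrier

/-- The basic open set `D(a)` of the spectrum. -/
def basicOpenSet {A : Type u} [MultiringOps A] (a : A) : Set (MSpec A) := {p | a ∉ p.carrier}

namespace MIdeal

section

variable {A : Type u} [MultiringOps A]

/-- The ideal generated by a set: the smallest ideal that contains it. -/
def span (X : Set A) : MIdeal A where
  carrier := {a | ∀ I : MIdeal A, X ⊆ I.carrier → a ∈ I.carrier}
  zero_mem I _ := I.zero_mem
  add_mem ha hb hc I hI := I.add_mem (ha I hI) (hb I hI) hc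
  mul_mem a _ hb I hI := I.mul_mem a (hb I hI)

lemma subset_span (X : Set A) : X ⊆ (span X).carrier := fun _ hx _ hI => hI hx

lemma mem_span_self (x : A) : x ∈ (span {x}).carrier := subset_span _ rfl

variable [IsMultiring A]

/-- The ideal `(I : b)` of all `a` with `a * b ∈ I`. -/
def colon (I : MIdeal A) (b : A) : MIdeal A where
  carrier := {a | a * b ∈ I.carrier}
  zero_mem := by
    change 0 * b ∈ I.carrier
    rw [zero_mul]
    exact I.zero_mem
  add_mem ha hb hc := I.add_mem ha hb (IsMultiring.mul_mem b hc)
  mul_mem a c hc := by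
    change a * c * b ∈ I.carrier
    rw [mul_assoc]
    exact I.mul_mem a hc

/-- The prime ideal theorem. -/
theorem exists_prime (I : MIdeal A) (S : Submonoid A) (h : ∀ s ∈ S, s ∉ I.carrier) :
    ∃ p : MSpec A, I.carrier ⊆ p.carrier ∧ ∀ s ∈ S, s ∉ p.carrier := by
  obtain ⟨M, hIM, hM⟩ := zorn_subset_nonempty
    {T : Set A | ∃ J : MIdeal A, J.carrier = T ∧ ∀ s ∈ S, s ∉ T}
    (by
      intro c hc hchain hne
      have key : ∀ x ∈ ⋃₀ c, ∀ y ∈ ⋃₀ c, ∃ J : MIdeal A,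
          J.carrier ∈ c ∧ x ∈ J.carrier ∧ y ∈ J.carrier := by
        rintro x ⟨T, hT, hx⟩ y ⟨T', hT', hy⟩
        rcases hchain.total hT hT' with hle | hle
        · obtain ⟨J, rfl, -⟩ := hc hT'
          exact ⟨J, hT', hle hx, hy⟩
        · obtain ⟨J, rfl, -⟩ := hc hT
          exact ⟨J, hT, hx, hle hy⟩
      refine ⟨⋃₀ c, ⟨⟨⋃₀ c, ?_, ?_, ?_⟩, rfl, ?_⟩, fun s hs => Set.subset_sUnion_of_mem hs⟩
      · obtain ⟨T, hT⟩ := hne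
        obtain ⟨J, rfl, -⟩ := hc hT
        exact ⟨_, hT, J.zero_mem⟩
      · intro a b d ha hb hd
        obtain ⟨J, hJ, h1, h2⟩ := key a ha b hb
        exact ⟨_, hJ, J.add_mem h1 h2 hd⟩
      · intro a b hb
        obtain ⟨J, hJ, h1, -⟩ := key b hb b hb
        exact ⟨_, hJ, J.mul_mem a h1⟩
      · rintro s hs ⟨T, hT, hsT⟩
        obtain ⟨J, rfl, h2⟩ := hc hT
        exact h2 s hs hsT)
    I.carrier ⟨I, rfl, h⟩
  obtain ⟨⟨J, rfl, hJ⟩, hmax⟩ := hM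
  have meet : ∀ a ∉ J.carrier, ∃ s ∈ S, s ∈ (span (J.carrier ∪ {a})).carrier := by
    intro a ha
    by_contra! hcon
    exact ha (hmax (y := (span (J.carrier ∪ {a})).carrier) ⟨_, rfl, hcon⟩
      (fun x hx => subset_span _ (Or.inl hx)) (subset_span _ (Or.inr rfl)))
  refine ⟨{ J with one_notMem := hJ 1 S.one_mem, mem_or_mem := ?_ }, hIM, hJ⟩
  intro a b hab
  by_contra! hcon
  obtain ⟨s, hs, hsa⟩ := meet a hcon.1
  obtain ⟨t, ht, htb⟩ := meet b hcon.2
  have h1 : s * b ∈ J.carrier := by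
    refine hsa (J.colon b) ?_
    rintro x (hx | rfl)
    · change x * b ∈ J.carrier
      rw [mul_comm]
      exact J.mul_mem b hx
    · exact hab
  have h2 : t * s ∈ J.carrier := by
    refine htb (J.colon s) ?_
    rintro x (hx | rfl)
    · change x * s ∈ J.carrier
      rw [mul_comm]
      exact J.mul_mem s hx
    · change x * s ∈ J.carrier
      rw [mul_comm]
      exact h1
  exact hJ _ (S.mul_mem ht hs) h2

end

/-! ### Quotient by an ideal -/

variable {A : Type u} [MultiringOps A] [IsMultiring A] (I : MIdeal A)

lemma neg_mem {a : A} (h : a ∈ I.carrier) : -a ∈ I.carrier := by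
  have := I.mul_mem (-1) h
  rwa [IsMultiring.neg_mul, one_mul] at this

/-- `a ∼ b` if and only if `a - b` meets `I`. -/
def rel (a b : A) : Prop := ∃ i ∈ I.carrier, i ∈ a +ₕ -b

lemma rel_iff {a b : A} : I.rel a b ↔ ∃ i ∈ I.carrier, a ∈ i +ₕ b := by
  constructor
  · rintro ⟨i, hi, h⟩
    have := IsMultiring.rev_right h
    rw [IsMultiring.neg_neg] at this
    exact ⟨i, hi, this⟩
  · rintro ⟨i, hi, h⟩
    exact ⟨i, hi, IsMultiring.rev_right h⟩

lemma rel_of_mem {a b i : A} (hi : i ∈ I.carrier) (h : a ∈ i +ₕ b) : I.rel a b :=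
  I.rel_iff.2 ⟨i, hi, h⟩

lemma rel_symm {a b : A} (h : I.rel a b) : I.rel b a := by
  obtain ⟨i, hi, h⟩ := I.rel_iff.1 h
  exact I.rel_of_mem (I.neg_mem hi) (IsMultiring.rev_left h)

lemma rel_trans {a b c : A} (h : I.rel a b) (h' : I.rel b c) : I.rel a c := by
  obtain ⟨i, hi, h⟩ := I.rel_iff.1 h
  obtain ⟨j, hj, h'⟩ := I.rel_iff.1 h'
  rw [IsMultiring.comm] at h h'
  obtain ⟨k, hk, h2⟩ := IsMultiring.assoc h h'
  rw [IsMultiring.comm] at h2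
  exact I.rel_of_mem (I.add_mem hj hi hk) h2

lemma rel_mul {a b : A} (c : A) (h : I.rel a b) : I.rel (a * c) (b * c) := by
  obtain ⟨i, hi, h⟩ := I.rel_iff.1 h
  refine I.rel_of_mem (i := i * c) ?_ (IsMultiring.mul_mem c h)
  rw [mul_comm]
  exact I.mul_mem c hi

lemma rel_neg {a b : A} (h : I.rel a b) : I.rel (-a) (-b) := by
  obtain ⟨i, hi, h⟩ := I.rel_iff.1 h
  exact I.rel_of_mem (I.neg_mem hi) (IsMultiring.neg_mem h)

/-- The equivalence relation modulo `I`, which is compatible with the product. -/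
def con : Con A where
  r := I.rel
  iseqv := ⟨fun a => ⟨0, I.zero_mem, IsMultiring.zero_mem a⟩, I.rel_symm, I.rel_trans⟩
  mul' {a b c d} h h' := by
    refine I.rel_trans (I.rel_mul c h) ?_
    rw [mul_comm b c, mul_comm b d]
    exact I.rel_mul b h'

/-- The quotient `A / I`. -/
def Quo : Type u := I.con.Quotient

/-- The projection `A → A / I`. -/
def proj (a : A) : I.Quo := (a : I.con.Quotient)

lemma proj_surjective : Function.Surjective I.proj := fun x => Con.induction_on x fun a => ⟨a, rfl⟩

lemma proj_eq_proj {a b : A} : I.proj a = I.proj b ↔ I.rel a b := Con.eq _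

/-- `ζ ∈ ξ + η` in `A / I` if and only if this holds for some representatives in `A`. -/
instance : MultiringOps I.Quo where
  __ := (inferInstance : CommMonoid I.con.Quotient)
  zero := I.proj 0
  zero_mul x := by
    obtain ⟨a, rfl⟩ := I.proj_surjective x
    exact congrArg I.proj (zero_mul a)
  mul_zero x := by
    obtain ⟨a, rfl⟩ := I.proj_surjective x
    exact congrArg I.proj (mul_zero a)
  neg x := Con.liftOn x (fun a => I.proj (-a)) fun _ _ h => I.proj_eq_proj.2 (I.rel_neg h)
  hadd ξ η := {ζ | ∃ a b c, I.proj a = ζ ∧ I.proj b = ξ ∧ I.proj c = η ∧ a ∈ b +ₕ c}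

lemma proj_mul (a b : A) : I.proj (a * b) = I.proj a * I.proj b := rfl

lemma proj_neg (a : A) : I.proj (-a) = -I.proj a := rfl

lemma proj_zero : I.proj 0 = 0 := rfl

lemma proj_one : I.proj 1 = 1 := rfl

lemma proj_hadd {a b c : A} (h : a ∈ b +ₕ c) : I.proj a ∈ I.proj b +ₕ I.proj c :=
  ⟨a, b, c, rfl, rfl, rfl, h⟩

lemma proj_eq_zero {a : A} : I.proj a = 0 ↔ a ∈ I.carrier := by
  rw [← proj_zero, proj_eq_proj]
  constructor
  · rintro ⟨i, hi, h⟩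
    rw [IsMultiring.neg_zero, IsMultiring.mem_add_zero] at h
    exact h ▸ hi
  · intro h
    exact I.rel_of_mem h (IsMultiring.self_mem a)

instance : IsMultiring I.Quo where
  nonempty x y := by
    obtain ⟨a, rfl⟩ := I.proj_surjective x
    obtain ⟨b, rfl⟩ := I.proj_surjective y
    obtain ⟨c, hc⟩ := IsMultiring.nonempty a b
    exact ⟨_, I.proj_hadd hc⟩
  rev_left := by
    rintro _ _ _ ⟨a, b, c, rfl, rfl, rfl, h⟩
    exact I.proj_hadd (IsMultiring.rev_left h)
  rev_right := by
    rintro _ _ _ ⟨a, b, c, rfl, rfl, rfl, h⟩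
    exact I.proj_hadd (IsMultiring.rev_right h)
  mem_add_zero {x y} := by
    constructor
    · rintro ⟨a, b, c, rfl, rfl, hc, h⟩
      rw [proj_eq_zero] at hc
      rw [IsMultiring.comm] at h
      exact I.proj_eq_proj.2 (I.rel_of_mem hc h)
    · rintro rfl
      obtain ⟨a, rfl⟩ := I.proj_surjective x
      exact I.proj_hadd (IsMultiring.self_mem a)
  assoc := by
    rintro _ _ _ _ _ ⟨x, g, c, rfl, rfl, rfl, hx⟩ ⟨g', a, b, hg, rfl, rfl, hg'⟩
    obtain ⟨i, hi, hgi⟩ := I.rel_iff.1 (I.rel_symm (I.proj_eq_proj.1 hg))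
    obtain ⟨k, hk, hxk⟩ := IsMultiring.assoc hx hgi
    obtain ⟨h, hh, hkh⟩ := IsMultiring.assoc hk hg'
    refine ⟨_, I.proj_hadd hh, ?_⟩
    rw [I.proj_eq_proj.2 (I.rel_of_mem hi hxk)]
    exact I.proj_hadd hkh
  comm x y := by
    ext z
    constructor <;>
    · rintro ⟨a, b, c, rfl, rfl, rfl, h⟩
      rw [IsMultiring.comm] at h
      exact I.proj_hadd h
  mul_mem := by
    rintro _ _ _ d ⟨a, b, c, rfl, rfl, rfl, h⟩
    obtain ⟨d, rfl⟩ := I.proj_surjective d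
    exact I.proj_hadd (IsMultiring.mul_mem d h)

end MIdeal

/-! ### Localization -/

section Localization

variable {A : Type u} [MultiringOps A] [IsMultiring A] (S : Submonoid A)

/-- `S⁻¹A`, on the localization of the multiplicative monoid: `a/s ∈ b/t + c/r` if and only if
`a t r v ∈ b s r v + c s t v` for some `v ∈ S`. -/
instance Localization.multiringOps : MultiringOps (Localization S) where
  __ := (inferInstance : CommMonoidWithZero (Localization S))
  neg x := x.liftOn (fun a s => Localization.mk (-a) s) (by
    intro a c b d h
    rw [Localization.r_iff_exists] at h
    obtain ⟨k, hk⟩ := h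
    rw [Localization.mk_eq_mk_iff, Localization.r_iff_exists]
    refine ⟨k, ?_⟩
    have e : ∀ x y : A, x * -y = -(x * y) := fun x y => by
      rw [mul_comm, IsMultiring.neg_mul, mul_comm]
    simp only [e]
    exact congrArg Neg.neg hk)
  hadd ξ η := {ζ | ∃ (a b c : A) (s t r : S),
    Localization.mk a s = ζ ∧ Localization.mk b t = ξ ∧ Localization.mk c r = η ∧
    ∃ v : S, a * t * r * v ∈ (b * s * r * v : A) +ₕ c * s * t * v}

end Localization

/-! ### Residue hyperfields -/

/-- Multidomains (with `1 ≠ 0`). -/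
class IsMultidomain (D : Type u) [MultiringOps D] : Prop where
  one_ne_zero : (1 : D) ≠ 0
  eq_zero_or {a b : D} : a * b = 0 → a = 0 ∨ b = 0

/-- The nonzero elements of a multidomain. -/
def nonzeroElements (D : Type u) [MultiringOps D] [IsMultidomain D] : Submonoid D where
  carrier := {a | a ≠ 0}
  one_mem' := IsMultidomain.one_ne_zero
  mul_mem' ha hb h := (IsMultidomain.eq_zero_or h).elim ha hb

/-- The fraction hyperfield of a multidomain. -/
abbrev MFractionField (D : Type u) [MultiringOps D] [IsMultiring D] [IsMultidomain D] : Type u :=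
  Localization (nonzeroElements D)

namespace MSpec

variable {A : Type u} [MultiringOps A] [IsMultiring A]

instance (p : MSpec A) : IsMultidomain p.toMIdeal.Quo where
  one_ne_zero h := p.one_notMem (p.proj_eq_zero.1 h)
  eq_zero_or {x y} h := by
    obtain ⟨a, rfl⟩ := p.proj_surjective x
    obtain ⟨b, rfl⟩ := p.proj_surjective y
    rw [← MIdeal.proj_mul, MIdeal.proj_eq_zero] at h
    rw [MIdeal.proj_eq_zero, MIdeal.proj_eq_zero]
    exact p.mem_or_mem h

/-- The residue hyperfield `K_A(p)`, the fraction hyperfield of `A / p`. -/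
abbrev K (p : MSpec A) : Type u := MFractionField p.toMIdeal.Quo

/-- The element `x / y` of `K_A(p)`, for `p ∈ D(y)`. -/
def frac (p : MSpec A) (x y : A) (hy : p ∈ basicOpenSet y) : p.K :=
  Localization.mk (p.proj x) ⟨p.proj y, fun h => hy (p.proj_eq_zero.1 h)⟩

end MSpec

/-! ### The spectrum and the structural presheaf -/

section Spectrum

variable {A : Type u} [MultiringOps A]

/-- The spectral topology, generated by the sets `D(a)`. -/
instance : TopologicalSpace (MSpec A) :=
  TopologicalSpace.generateFrom (Set.range basicOpenSet)

lemma basicOpenSet_mul_subset_left (a b : A) : basicOpenSet (a * b) ⊆ basicOpenSet a := by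
  intro p hp ha
  refine hp ?_
  rw [mul_comm]
  exact p.mul_mem b ha

lemma basicOpenSet_mul_subset_right (a b : A) : basicOpenSet (a * b) ⊆ basicOpenSet b :=
  fun p hp hb => hp (p.mul_mem a hb)

lemma basicOpenSet_subset_of_cover {e : A} {ι : Type w} {c : ι → A}
    (hc : basicOpenSet e = ⋃ i, basicOpenSet (c i)) (i : ι) :
    basicOpenSet (c i) ⊆ basicOpenSet e := by
  rw [hc]
  exact Set.subset_iUnion (fun i => basicOpenSet (c i)) i

variable [IsMultiring A]

/-- The multiplicative set `S_a` of all `x` such that some power of `a` lies in the ideal `(x)`. -/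
def powerDivisors (a : A) : Submonoid A where
  carrier := {x | ∃ n : ℕ, a ^ n ∈ (MIdeal.span {x}).carrier}
  one_mem' := ⟨0, by rw [pow_zero]; exact MIdeal.mem_span_self 1⟩
  mul_mem' {x y} := by
    rintro ⟨m, hm⟩ ⟨n, hn⟩
    have h1 : a ^ m * y ∈ (MIdeal.span {x * y}).carrier := by
      refine hm ((MIdeal.span {x * y}).colon y) ?_
      rintro _ rfl
      exact MIdeal.mem_span_self _
    have h2 : a ^ n * a ^ m ∈ (MIdeal.span {x * y}).carrier := by
      refine hn ((MIdeal.span {x * y}).colon (a ^ m)) ?_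
      rintro z rfl
      change z * a ^ m ∈ (MIdeal.span {x * z}).carrier
      rwa [mul_comm z]
    exact ⟨n + m, by rwa [pow_add]⟩

lemma powerDivisors_le {a b : A} (h : basicOpenSet b ⊆ basicOpenSet a) :
    powerDivisors a ≤ powerDivisors b := by
  rintro x ⟨n, hn⟩
  by_contra hx
  obtain ⟨p, hp, hp'⟩ := MIdeal.exists_prime (MIdeal.span {x}) (Submonoid.powers b) (by
    rintro _ ⟨k, rfl⟩ hk
    exact hx ⟨k, hk⟩)
  have hb : a ∉ p.carrier := h (hp' b (Submonoid.mem_powers b))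
  have hpow : ∀ k : ℕ, a ^ k ∉ p.carrier := by
    intro k
    induction k with
    | zero => rw [pow_zero]; exact p.one_notMem
    | succ k ih =>
      rw [pow_succ]
      intro hk
      exact (p.mem_or_mem hk).elim ih hb
  exact hpow n (hp hn)

/-- The value `S_a⁻¹A` of the structural presheaf on `D(a)`. -/
abbrev presheafSections (a : A) : Type u := Localization (powerDivisors a)

/-- The restriction map `x / s ↦ x / s` of the structural presheaf, for `D(b) ⊆ D(a)`. -/
def presheafRes {a b : A} (h : basicOpenSet b ⊆ basicOpenSet a) (x : presheafSections a) :
    presheafSections b :=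
  x.liftOn (fun y s => Localization.mk y ⟨s, powerDivisors_le h s.2⟩) (by
    intro y z s t hr
    rw [Localization.r_iff_exists] at hr
    obtain ⟨k, hk⟩ := hr
    rw [Localization.mk_eq_mk_iff, Localization.r_iff_exists]
    exact ⟨⟨k, powerDivisors_le h k.2⟩, hk⟩)

variable (A)

/-- The structural presheaf is a monopresheaf. -/
def IsMonoMultiring : Prop :=
  ∀ (e : A) (ι : Type u) (c : ι → A) (hc : basicOpenSet e = ⋃ i, basicOpenSet (c i))
    (x y z : presheafSections e),
    (∀ i, presheafRes (basicOpenSet_subset_of_cover hc i) x ∈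
      presheafRes (basicOpenSet_subset_of_cover hc i) y +ₕ
      presheafRes (basicOpenSet_subset_of_cover hc i) z) →
    x ∈ y +ₕ z

/-- The structural presheaf is a sheaf. -/
def IsGeometric : Prop :=
  IsMonoMultiring A ∧
  ∀ (e : A) (ι : Type u) (c : ι → A) (hc : basicOpenSet e = ⋃ i, basicOpenSet (c i))
    (x : ∀ i, presheafSections (c i)),
    (∀ i j, presheafRes (basicOpenSet_mul_subset_left (c i) (c j)) (x i) =
      presheafRes (basicOpenSet_mul_subset_right (c i) (c j)) (x j)) →
    ∃ y : presheafSections e, ∀ i,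
      presheafRes (basicOpenSet_subset_of_cover hc i) y = x i

/-- Hyperrings: multirings with full distributivity. -/
def IsHyperring (A : Type u) [MultiringOps A] : Prop :=
  ∀ b c d x : A, x ∈ b * d +ₕ c * d → ∃ a ∈ b +ₕ c, x = a * d

/-- Von Neumann hyperrings. -/
def IsVonNeumannHyperring (A : Type u) [MultiringOps A] : Prop :=
  IsHyperring A ∧ ∀ a : A, ∃ b : A, a = a ^ 2 * b

/-- Geometric von Neumann hyperrings. -/
def IsGvNH : Prop := IsVonNeumannHyperring A ∧ IsGeometric A

end Spectrum

/-! ### Constructible sections -/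

section Hull

variable {A : Type u} [MultiringOps A] [IsMultiring A]

/-- Constructible sections: locally, on clopen sets of the constructible topology of the spectrum,
they are given by a fraction `x / y`. -/
def IsConstructibleSection (f : ∀ p : MSpec A, p.K) : Prop :=
  ∀ p : MSpec A, ∃ (U : Set (MSpec A)) (x y : A) (hU : U ⊆ basicOpenSet y),
    @IsClopen _ (constructibleTopology (MSpec A)) U ∧ p ∈ U ∧
    ∀ (q : MSpec A) (hq : q ∈ U), f q = q.frac x y (hU hq)

variable (A)

/-- `V(A)`, the set of constructible sections. -/
def VHull : Type u := {f : ∀ p : MSpec A, p.K // IsConstructibleSection f}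

variable {A}

lemma isConstructibleSection_of (a : A) :
    IsConstructibleSection fun p : MSpec A => p.frac a 1 p.one_notMem := fun p =>
  ⟨Set.univ, a, 1, fun q _ => q.one_notMem, @isClopen_univ _ (constructibleTopology (MSpec A)),
    Set.mem_univ p, fun _ _ => rfl⟩

lemma IsConstructibleSection.mul {f g : ∀ p : MSpec A, p.K} (hf : IsConstructibleSection f)
    (hg : IsConstructibleSection g) : IsConstructibleSection fun p => f p * g p := by
  intro p
  obtain ⟨U, x, y, hU, hUc, hp, h⟩ := hf p
  obtain ⟨U', x', y', hU', hUc', hp', h'⟩ := hg p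
  refine ⟨U ∩ U', x * x', y * y', fun q hq hmem => (q.mem_or_mem hmem).elim (hU hq.1) (hU' hq.2),
    @IsClopen.inter _ (constructibleTopology (MSpec A)) _ _ hUc hUc', ⟨hp, hp'⟩, fun q hq => ?_⟩
  refine (congrArg₂ (· * ·) (h q hq.1) (h' q hq.2)).trans ?_
  exact Localization.mk_mul _ _ _ _

lemma IsConstructibleSection.neg {f : ∀ p : MSpec A, p.K} (hf : IsConstructibleSection f) :
    IsConstructibleSection fun p => -f p := by
  intro p
  obtain ⟨U, x, y, hU, hUc, hp, h⟩ := hf p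
  refine ⟨U, -x, y, hU, hUc, hp, fun q hq => ?_⟩
  exact congrArg Neg.neg (h q hq)

/-- All operations of `V(A)` are pointwise; in particular `f ∈ g + h` if and only if
`f(p) ∈ g(p) + h(p)` for all `p`. -/
instance : MultiringOps (VHull A) where
  mul f g := ⟨fun p => f.1 p * g.1 p, f.2.mul g.2⟩
  one := ⟨fun p => 1, by
    have h : (fun p : MSpec A => (1 : p.K)) = fun p => p.frac 1 1 p.one_notMem :=
      funext fun p => (Localization.mk_self (1 : nonzeroElements p.toMIdeal.Quo)).symm
    rw [h]
    exact isConstructibleSection_of 1⟩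
  zero := ⟨fun p => 0, by
    have h : (fun p : MSpec A => (0 : p.K)) = fun p => p.frac 0 1 p.one_notMem :=
      funext fun p => (Localization.mk_zero (1 : nonzeroElements p.toMIdeal.Quo)).symm
    rw [h]
    exact isConstructibleSection_of 0⟩
  neg f := ⟨fun p => -f.1 p, f.2.neg⟩
  mul_assoc f g h := Subtype.ext (funext fun p => mul_assoc _ _ _)
  mul_comm f g := Subtype.ext (funext fun p => mul_comm _ _)
  one_mul f := Subtype.ext (funext fun p => one_mul _)
  mul_one f := Subtype.ext (funext fun p => mul_one _)
  zero_mul f := Subtype.ext (funext fun p => zero_mul _)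
  mul_zero f := Subtype.ext (funext fun p => mul_zero _)
  hadd g h := {f | ∀ p, f.1 p ∈ g.1 p +ₕ h.1 p}

variable (A)

/-- The natural map `v_A : A → V(A)`, `v_A(a)(p) = a / 1`. -/
def toVHull : MultiringHom A (VHull A) where
  toFun a := ⟨fun p => p.frac a 1 p.one_notMem, isConstructibleSection_of a⟩
  map_hadd {a b c} h p :=
    ⟨p.proj a, p.proj b, p.proj c, ⟨p.proj 1, _⟩, ⟨p.proj 1, _⟩, ⟨p.proj 1, _⟩, rfl, rfl, rfl, 1, by
      simpa [MIdeal.proj_one] using p.proj_hadd h⟩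
  map_mul a b := Subtype.ext (funext fun p => by
    change p.frac (a * b) 1 p.one_notMem = p.frac a 1 p.one_notMem * p.frac b 1 p.one_notMem
    refine Eq.trans ?_ (Localization.mk_mul _ _ _ _).symm
    refine congrArg₂ _ rfl (Subtype.ext ?_)
    change p.proj 1 = p.proj 1 * p.proj 1
    rw [← MIdeal.proj_mul, mul_one])
  map_zero := Subtype.ext (funext fun p =>
    Localization.mk_zero (1 : nonzeroElements p.toMIdeal.Quo))
  map_one := Subtype.ext (funext fun p =>
    Localization.mk_self (1 : nonzeroElements p.toMIdeal.Quo))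
  map_neg _ := rfl

end Hull

/-! ### Categories -/

open CategoryTheory

/-- The category of multirings. -/
structure MultiCat : Type (u + 1) where
  carrier : Type u
  [ops : MultiringOps carrier]
  [isMultiring : IsMultiring carrier]

attribute [instance] MultiCat.ops MultiCat.isMultiring

instance : Category MultiCat.{u} where
  Hom A B := MultiringHom A.carrier B.carrier
  id A := MultiringHom.id A.carrier
  comp f g := g.comp f

/-- The property of being a geometric von Neumann hyperring. -/
def gvnhProperty : ObjectProperty MultiCat.{u} := fun A => IsGvNH A.carrier

/-- The category of geometric von Neumann hyperrings, a full subcategory of the multirings. -/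
abbrev GvNHCat : Type (u + 1) := gvnhProperty.{u}.FullSubcategory

/-- `V(A)` as an object of the category of geometric von Neumann hyperrings. -/
abbrev MultiCat.hull (A : MultiCat.{u}) (hM : IsMultiring (VHull A.carrier))
    (hG : IsGvNH (VHull A.carrier)) : GvNHCat.{u} :=
  ⟨⟨VHull A.carrier⟩, hG⟩

open Filter

/-! ### Localizations are multirings -/

section Localization

variable {A : Type u} [MultiringOps A] [IsMultiring A] {S : Submonoid A}

/-! Two mechanisms carry the proof: gluing over a compact space with clopen neighbourhood bases, and
cancellation in hyperfields.

The constructible topology is generated by the sets `D(a)` and their complements, and it is compact: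
an ultrafilter of primes converges to the prime of all elements that lie in almost every member. A
relation `f ∈ g + h` between fractions at `p` is witnessed by finitely many elements lying in or
outside `p` (`MSpec.frac_mem_hadd_iff`), so it spreads to a neighbourhood. Hence an existence
problem for sections, made of such relations, need only be solved in each residue hyperfield;
compactness and clopen patching give a global solution (`VHull.exists_forall_of_eventually`). This
yields the multiring axioms, full distributivity, the weak inverses `a = a²b` and the gluing of the
structural sheaf. The sheaf is tractable because equality and sums in `S_e⁻¹V(A)` can be tested
pointwise where `e` does not vanish.

If `B` is a geometric von Neumann hyperring, then `v_B` is bijective and reflects sums. Indeed every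
`a ∈ p` is annihilated by some `t ∉ p`, so the sets `D(e)` alone form a basis of the constructible
topology. Local information in the residue hyperfields therefore becomes information on a cover of
`D(1)`, which the sheaf property descends to `B`, the elements of `S_1` being units.

Primes pull back along a morphism `A → B` and residue hyperfields map forward, which gives `V(f)`;
composing with `v_B⁻¹` gives the lift to `B`. For uniqueness (`hull_hom_ext`), evaluation at a prime
reduces to a morphism `k` from `V(A)` to a hyperfield. If `p` is the kernel of `k ∘ v_A` and `s` is
`x/y` near `p`, then `k(s) · k(v_A(y)) = k(v_A(x))` with `k(v_A(y)) ≠ 0`, so `k(s)` is determined.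
-/

theorem Localization.mk_mem_hadd_iff {x y z : A} {s t r : S} :
    Localization.mk x s ∈ Localization.mk y t +ₕ Localization.mk z r ↔
      ∃ v : S, x * t * r * v ∈ (y * s * r * v : A) +ₕ z * s * t * v := by
  constructor
  · rintro ⟨a, b, c, s', t', r', hx, hy, hz, v, h⟩
    rw [Localization.mk_eq_mk_iff, Localization.r_iff_exists] at hx hy hz
    obtain ⟨k₁, h₁⟩ := hx
    obtain ⟨k₂, h₂⟩ := hy
    obtain ⟨k₃, h₃⟩ := hz
    replace h₁ : (k₁ * (s * a) : A) = k₁ * (s' * x) := h₁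
    replace h₂ : (k₂ * (t * b) : A) = k₂ * (t' * y) := h₂
    replace h₃ : (k₃ * (r * c) : A) = k₃ * (r' * z) := h₃
    -- Multiplying `h` by `k₁ k₂ k₃ s t r` gives each term the factors needed to apply its own
    -- fraction identity; the primed denominators that come out are absorbed into the witness.
    refine ⟨v * k₁ * k₂ * k₃ * s' * t' * r', ?_⟩
    have := IsMultiring.mul_mem (k₁ * k₂ * k₃ * s * t * r : A) h
    have e₁ : a * t' * r' * v * (k₁ * k₂ * k₃ * s * t * r : A) =
        x * t * r * (v * k₁ * k₂ * k₃ * s' * t' * r' : A) := by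
      calc _ = (k₁ * (s * a) : A) * (t' * r' * v * k₂ * k₃ * t * r : A) := by ac_rfl
        _ = _ := by rw [h₁]; ac_rfl
    have e₂ : b * s' * r' * v * (k₁ * k₂ * k₃ * s * t * r : A) =
        y * s * r * (v * k₁ * k₂ * k₃ * s' * t' * r' : A) := by
      calc _ = (k₂ * (t * b) : A) * (s' * r' * v * k₁ * k₃ * s * r : A) := by ac_rfl
        _ = _ := by rw [h₂]; ac_rfl
    have e₃ : c * s' * t' * v * (k₁ * k₂ * k₃ * s * t * r : A) =
        z * s * t * (v * k₁ * k₂ * k₃ * s' * t' * r' : A) := by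
      calc _ = (k₃ * (r * c) : A) * (s' * t' * v * k₁ * k₂ * s * t : A) := by ac_rfl
        _ = _ := by rw [h₃]; ac_rfl
    rw [e₁, e₂, e₃] at this
    exact_mod_cast this
  · rintro ⟨v, h⟩
    exact ⟨x, y, z, s, t, r, rfl, rfl, rfl, v, h⟩

theorem Localization.mk_mem_hadd_iff_of_common_denom {x y z : A} {s : S} :
    Localization.mk x s ∈ Localization.mk y s +ₕ Localization.mk z s ↔
      ∃ v : S, x * v ∈ (y * v : A) +ₕ z * v := by
  rw [Localization.mk_mem_hadd_iff]
  constructor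
  · rintro ⟨v, h⟩
    -- With a common denominator, cross-multiplication contributes the factor `s * s` to every term.
    exact ⟨s * s * v, by simpa only [Submonoid.coe_mul, ← mul_assoc] using h⟩
  · rintro ⟨v, h⟩
    refine ⟨v, ?_⟩
    have := IsMultiring.mul_mem (s * s : A) h
    have e : ∀ a : A, a * v * (s * s) = a * s * s * v := fun a => by ac_rfl
    rwa [e, e, e] at this

theorem Localization.exists_common_denom₂ {M : Type*} [CommMonoid M] {S : Submonoid M}
    (x y : Localization S) :
    ∃ (a b : M) (s : S), x = Localization.mk a s ∧ y = Localization.mk b s := by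
  induction x using Localization.induction_on with | _ x =>
  induction y using Localization.induction_on with | _ y =>
  obtain ⟨a, s⟩ := x
  obtain ⟨b, t⟩ := y
  refine ⟨a * t, b * s, s * t, ?_, ?_⟩ <;>
  · rw [Localization.mk_eq_mk_iff, Localization.r_iff_exists]
    refine ⟨1, ?_⟩
    push_cast
    ac_rfl

theorem Localization.mk_eq_mk_mul {M : Type*} [CommMonoid M] {S : Submonoid M} (a : M)
    (s t : S) :
    Localization.mk a s = Localization.mk (a * t) (s * t) := by
  rw [Localization.mk_eq_mk_iff, Localization.r_iff_exists]
  refine ⟨1, ?_⟩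
  push_cast
  ac_rfl

theorem Localization.exists_common_denom₃ {M : Type*} [CommMonoid M] {S : Submonoid M}
    (x y z : Localization S) : ∃ (a b c : M) (s : S),
      x = Localization.mk a s ∧ y = Localization.mk b s ∧ z = Localization.mk c s := by
  obtain ⟨a, b, s, rfl, rfl⟩ := Localization.exists_common_denom₂ x y
  induction z using Localization.induction_on with | _ z =>
  obtain ⟨c, t⟩ := z
  refine ⟨a * t, b * t, c * s, s * t, Localization.mk_eq_mk_mul _ _ _,
    Localization.mk_eq_mk_mul _ _ _, ?_⟩
  rw [mul_comm s t]
  exact Localization.mk_eq_mk_mul _ _ _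

theorem Localization.multiring_neg_mk (a : A) (s : S) :
    -Localization.mk a s = Localization.mk (-a) s := rfl

instance Localization.isMultiring : IsMultiring (Localization S) where
  nonempty x y := by
    obtain ⟨a, b, s, rfl, rfl⟩ := Localization.exists_common_denom₂ x y
    obtain ⟨c, hc⟩ := IsMultiring.nonempty a b
    exact ⟨Localization.mk c s, Localization.mk_mem_hadd_iff_of_common_denom.2
      ⟨1, by simpa using hc⟩⟩
  rev_left {x y z} h := by
    obtain ⟨a, b, c, s, rfl, rfl, rfl⟩ := Localization.exists_common_denom₃ x y z
    rw [Localization.multiring_neg_mk]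
    rw [Localization.mk_mem_hadd_iff_of_common_denom] at h ⊢
    obtain ⟨v, h⟩ := h
    refine ⟨v, ?_⟩
    rw [IsMultiring.neg_mul]
    exact IsMultiring.rev_left h
  rev_right {x y z} h := by
    obtain ⟨a, b, c, s, rfl, rfl, rfl⟩ := Localization.exists_common_denom₃ x y z
    rw [Localization.multiring_neg_mk]
    rw [Localization.mk_mem_hadd_iff_of_common_denom] at h ⊢
    obtain ⟨v, h⟩ := h
    refine ⟨v, ?_⟩
    rw [IsMultiring.neg_mul]
    exact IsMultiring.rev_right h
  mem_add_zero {x y} := by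
    obtain ⟨a, b, s, rfl, rfl⟩ := Localization.exists_common_denom₂ x y
    rw [← Localization.mk_zero s, Localization.mk_mem_hadd_iff_of_common_denom,
      Localization.mk_eq_mk_iff, Localization.r_iff_exists]
    simp only [zero_mul, IsMultiring.mem_add_zero]
    constructor
    · rintro ⟨v, h⟩
      refine ⟨v, ?_⟩
      rw [mul_left_comm, mul_comm _ a, h]
      ac_rfl
    · rintro ⟨v, h⟩
      refine ⟨v * s, ?_⟩
      push_cast
      refine Eq.trans ?_ (h.trans ?_) <;> ac_rfl
  assoc {x y z g t} h h' := by
    obtain ⟨a, b, s, rfl, rfl⟩ := Localization.exists_common_denom₂ x y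
    obtain ⟨c, k, r, rfl, rfl⟩ := Localization.exists_common_denom₂ z g
    induction t using Localization.induction_on with | _ t =>
    obtain ⟨e, q⟩ := t
    -- All five fractions are brought to the common denominator `q * (s * r)`, so that associativity
    -- in `A` applies to the numerators.
    rw [Localization.mk_eq_mk_mul e q (s * r)] at h ⊢
    rw [Localization.mk_eq_mk_mul k r (q * s)] at h h'
    rw [Localization.mk_eq_mk_mul c r (q * s)] at h ⊢
    rw [Localization.mk_eq_mk_mul a s (q * r)] at h' ⊢
    rw [Localization.mk_eq_mk_mul b s (q * r)] at h' ⊢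
    have e₁ : s * (q * r) = q * (s * r) := by ac_rfl
    have e₂ : r * (q * s) = q * (s * r) := by ac_rfl
    simp only [e₁, e₂] at h h' ⊢
    clear e₁ e₂
    generalize q * (s * r) = m at *
    generalize e * _ = e at *
    generalize k * _ = k at *
    generalize c * _ = c at *
    generalize a * _ = a at *
    generalize b * _ = b at *
    rw [Localization.mk_mem_hadd_iff_of_common_denom] at h h'
    obtain ⟨v, h⟩ := h
    obtain ⟨w, h'⟩ := h'
    -- The intermediate term `k` occurs as `k * v` in one relation and as `k * w` in the other;
    -- cross-multiplying makes it the same element.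
    have h := IsMultiring.mul_mem (w : A) h
    have h' := IsMultiring.mul_mem (v : A) h'
    rw [mul_right_comm k] at h
    obtain ⟨d, hd, hx⟩ := IsMultiring.assoc h h'
    rw [mul_right_comm b] at hd
    rw [mul_right_comm a] at hx
    simp only [mul_assoc] at hd hx
    refine ⟨Localization.mk d (m * (v * w)), ?_, ?_⟩
    · rw [Localization.mk_eq_mk_mul b m (v * w), Localization.mk_eq_mk_mul c m (v * w),
        Localization.mk_mem_hadd_iff_of_common_denom]
      exact ⟨1, by simpa using hd⟩
    · rw [Localization.mk_eq_mk_mul e m (v * w), Localization.mk_eq_mk_mul a m (v * w),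
        Localization.mk_mem_hadd_iff_of_common_denom]
      exact ⟨1, by simpa using hx⟩
  comm x y := by
    obtain ⟨a, b, s, rfl, rfl⟩ := Localization.exists_common_denom₂ x y
    ext z
    constructor <;>
    · rintro ⟨a, b, c, s, t, r, hx, hy, hz, v, h⟩
      refine ⟨a, c, b, s, r, t, hx, hz, hy, v, ?_⟩
      rw [IsMultiring.comm] at h
      rwa [mul_right_comm a]
  mul_mem {x y z} d h := by
    obtain ⟨a, b, c, s, rfl, rfl, rfl⟩ := Localization.exists_common_denom₃ x y z
    induction d using Localization.induction_on with | _ d =>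
    obtain ⟨d, t⟩ := d
    rw [Localization.mk_mem_hadd_iff_of_common_denom] at h
    obtain ⟨v, h⟩ := h
    simp only [Localization.mk_mul]
    rw [Localization.mk_mem_hadd_iff_of_common_denom]
    refine ⟨v, ?_⟩
    have := IsMultiring.mul_mem d h
    simpa only [mul_right_comm _ (v : A) d] using this

end Localization

/-! ### The constructible topology of the spectrum -/

namespace MSpec

section Topology

open Topology

variable {A : Type u} [MultiringOps A]

theorem mul_mem_iff (p : MSpec A) {a b : A} :
    a * b ∈ p.carrier ↔ a ∈ p.carrier ∨ b ∈ p.carrier := by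
  refine ⟨p.mem_or_mem, ?_⟩
  rintro (h | h)
  · rw [mul_comm]
    exact p.mul_mem b h
  · exact p.mul_mem a h

theorem pow_notMem {p : MSpec A} {a : A} (h : a ∉ p.carrier) (n : ℕ) :
    a ^ n ∉ p.carrier := by
  induction n with
  | zero => rw [pow_zero]; exact p.one_notMem
  | succ n ih =>
    rw [pow_succ, p.mul_mem_iff, not_or]
    exact ⟨ih, h⟩

/-- The topology generated by the basic open sets and their complements. -/
abbrev patchTopology (A : Type u) [MultiringOps A] : TopologicalSpace (MSpec A) :=
  .generateFrom ({s | ∃ a : A, s = basicOpenSet a} ∪ {s | ∃ a : A, s = (basicOpenSet a)ᶜ})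

theorem isClopen_patchTopology (a : A) : @IsClopen _ (patchTopology A) (basicOpenSet a) := by
  refine ⟨@IsClosed.mk _ (patchTopology A) _ ?_, ?_⟩
  · exact TopologicalSpace.isOpen_generateFrom_of_mem (Or.inr ⟨a, rfl⟩)
  · exact TopologicalSpace.isOpen_generateFrom_of_mem (Or.inl ⟨a, rfl⟩)

/-- An ultrafilter of primes converges to the set of elements that lie in almost all of them. This
is an ideal, and it is prime because an ultrafilter decides disjunctions. -/
theorem compactSpace_patchTopology : @CompactSpace (MSpec A) (patchTopology A) := by
  let := patchTopology A
  refine ⟨isCompact_iff_ultrafilter_le_nhds.2 fun F _ => ?_⟩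
  let p : MSpec A :=
    { carrier := {a | ∀ᶠ q : MSpec A in F, a ∈ q.carrier}
      zero_mem := Eventually.of_forall fun q => q.zero_mem
      add_mem := by
        intro a b c ha hb h
        filter_upwards [ha, hb] with q ha hb using q.add_mem ha hb h
      mul_mem := by
        intro a b hb
        filter_upwards [hb] with q hb using q.mul_mem a hb
      one_notMem := by
        intro h
        obtain ⟨q, hq⟩ := Eventually.exists (f := (F : Filter (MSpec A))) h
        exact q.one_notMem hq
      mem_or_mem := by
        intro a b h
        refine Ultrafilter.eventually_or.1 ?_
        filter_upwards [h] with q h using q.mem_or_mem h }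
  refine ⟨p, Set.mem_univ p, ?_⟩
  rw [TopologicalSpace.nhds_generateFrom]
  refine le_iInf₂ ?_
  rintro _ ⟨hp, ⟨a, rfl⟩ | ⟨a, rfl⟩⟩
  · exact le_principal_iff.2 (Ultrafilter.eventually_not.2 hp)
  · refine le_principal_iff.2 ?_
    have h : a ∈ p.carrier := not_not.1 hp
    filter_upwards [h] with q hq using not_not.2 hq

theorem patchTopology_le : patchTopology A ≤ (inferInstance : TopologicalSpace (MSpec A)) := by
  refine le_generateFrom ?_
  rintro _ ⟨a, rfl⟩
  exact (isClopen_patchTopology a).2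

theorem isOpen_basicOpenSet (a : A) : IsOpen (basicOpenSet a) :=
  TopologicalSpace.isOpen_generateFrom_of_mem ⟨a, rfl⟩

theorem isCompact_basicOpenSet (a : A) : IsCompact (basicOpenSet a) := by
  have h := @IsClosed.isCompact _ (patchTopology A) _ compactSpace_patchTopology
    (isClopen_patchTopology a).1
  have := @IsCompact.image _ _ (patchTopology A) _ _ _ h (continuous_id_iff_le.2 patchTopology_le)
  rwa [Set.image_id] at this

theorem basicOpenSet_mul (a b : A) :
    basicOpenSet (a * b) = basicOpenSet a ∩ basicOpenSet b := by
  ext p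
  simp only [basicOpenSet, Set.mem_ofPred_eq, Set.mem_inter_iff, mul_mem_iff, not_or]

theorem exists_basicOpenSet_subset {U : Set (MSpec A)} (hU : IsOpen U) {p : MSpec A}
    (hp : p ∈ U) : ∃ a : A, p ∈ basicOpenSet a ∧ basicOpenSet a ⊆ U := by
  induction hU with
  | basic s hs =>
    obtain ⟨a, rfl⟩ := hs
    exact ⟨a, hp, subset_rfl⟩
  | univ => exact ⟨1, p.one_notMem, Set.subset_univ _⟩
  | inter s t _ _ ihs iht =>
    obtain ⟨a, ha, has⟩ := ihs hp.1
    obtain ⟨b, hb, hbt⟩ := iht hp.2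
    refine ⟨a * b, ?_, ?_⟩ <;> rw [basicOpenSet_mul]
    · exact ⟨ha, hb⟩
    · exact Set.inter_subset_inter has hbt
  | sUnion S _ ih =>
    obtain ⟨s, hs, hps⟩ := hp
    obtain ⟨a, ha, has⟩ := ih s hs hps
    exact ⟨a, ha, has.trans (Set.subset_sUnion_of_mem hs)⟩

/-- A compact open set is a finite union of basic open sets, each of which is clopen in the patch
topology. -/
theorem isClosed_patchTopology_of_isCompact {U : Set (MSpec A)} (hU : IsOpen U)
    (hc : IsCompact U) : IsClosed[patchTopology A] U := by
  obtain ⟨c, hcl, h₁, h₂⟩ : ∃ c, IsClosed[patchTopology A] c ∧ U ⊆ c ∧ c ⊆ U := by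
    refine hc.induction_on (p := fun s => ∃ c, IsClosed[patchTopology A] c ∧ s ⊆ c ∧ c ⊆ U)
      ⟨∅, @isClosed_empty _ (patchTopology A), subset_rfl, Set.empty_subset _⟩ ?_ ?_ ?_
    · rintro s t hst ⟨c, hc, h₁, h₂⟩
      exact ⟨c, hc, hst.trans h₁, h₂⟩
    · rintro s t ⟨c, hc, h₁, h₂⟩ ⟨d, hd, h₃, h₄⟩
      exact ⟨c ∪ d, @IsClosed.union _ _ _ (patchTopology A) hc hd, Set.union_subset_union h₁ h₃,
        Set.union_subset h₂ h₄⟩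
    · intro p hp
      obtain ⟨a, ha, haU⟩ := exists_basicOpenSet_subset hU hp
      exact ⟨basicOpenSet a, mem_nhdsWithin_of_mem_nhds ((isOpen_basicOpenSet a).mem_nhds ha),
        basicOpenSet a, (isClopen_patchTopology a).1, subset_rfl, haU⟩
  rwa [h₁.antisymm h₂]

theorem constructibleTopology_eq : constructibleTopology (MSpec A) = patchTopology A := by
  refine le_antisymm (le_generateFrom ?_) (le_generateFrom ?_)
  · rintro _ (⟨a, rfl⟩ | ⟨a, rfl⟩)
    · exact (isCompact_basicOpenSet a).isOpen_constructibleTopology_of_isOpen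
        (isOpen_basicOpenSet a)
    · refine IsCompact.isOpen_constructibleTopology_of_isClosed ?_
        (isOpen_basicOpenSet a).isClosed_compl
      rw [compl_compl]
      exact isCompact_basicOpenSet a
  · rintro s (⟨ho, -⟩ | ⟨hc, hs⟩)
    · exact patchTopology_le s ho
    · exact (@isClosed_compl_iff _ (patchTopology A) _).1
        (isClosed_patchTopology_of_isCompact hc.isOpen_compl hs)

theorem isClopen_basicOpenSet (a : A) :
    @IsClopen _ (constructibleTopology (MSpec A)) (basicOpenSet a) := by
  rw [constructibleTopology_eq]
  exact isClopen_patchTopology a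

/-- The neighbourhood filter of the constructible topology. -/
def cnhds (p : MSpec A) : Filter (MSpec A) := @nhds _ (constructibleTopology (MSpec A)) p

/-- The subbasis consists of the `D(a)` and their complements, so convergence to `p` is tested on
one element at a time. This is the tool for comparing other filters with the constructible
neighbourhoods. -/
theorem le_cnhds {p : MSpec A} {F : Filter (MSpec A)}
    (h₁ : ∀ a ∉ p.carrier, ∀ᶠ q : MSpec A in F, a ∉ q.carrier)
    (h₂ : ∀ a ∈ p.carrier, ∀ᶠ q : MSpec A in F, a ∈ q.carrier) : F ≤ p.cnhds := by
  rw [cnhds, constructibleTopology_eq, TopologicalSpace.nhds_generateFrom]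
  refine le_iInf₂ ?_
  rintro _ ⟨hp, ⟨a, rfl⟩ | ⟨a, rfl⟩⟩
  · exact le_principal_iff.2 (h₁ a hp)
  · refine le_principal_iff.2 ?_
    filter_upwards [h₂ a (not_not.1 hp)] with q hq using not_not.2 hq

theorem eventually_notMem {p : MSpec A} {a : A} (h : a ∉ p.carrier) :
    ∀ᶠ q in p.cnhds, a ∉ q.carrier :=
  @IsOpen.mem_nhds _ (constructibleTopology (MSpec A)) p _ (isClopen_basicOpenSet a).2 h

theorem eventually_mem {p : MSpec A} {a : A} (h : a ∈ p.carrier) :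
    ∀ᶠ q in p.cnhds, a ∈ q.carrier := by
  have := @IsOpen.mem_nhds _ (constructibleTopology (MSpec A)) p _
    (@IsClopen.compl _ (constructibleTopology (MSpec A)) _ (isClopen_basicOpenSet a)).2
    (not_not.2 h)
  filter_upwards [this] with q hq using not_not.1 hq

theorem _root_.Filter.Eventually.self_of_cnhds {p : MSpec A} {P : MSpec A → Prop}
    (h : ∀ᶠ q in p.cnhds, P q) : P p :=
  @Filter.Eventually.self_of_nhds _ (constructibleTopology (MSpec A)) _ _ h

theorem eventually_of_isClopen {p : MSpec A} {U : Set (MSpec A)}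
    (hU : @IsClopen _ (constructibleTopology (MSpec A)) U) (hp : p ∈ U) : ∀ᶠ q in p.cnhds, q ∈ U :=
  @IsOpen.mem_nhds _ (constructibleTopology (MSpec A)) p _ hU.2 hp

/-- The clopen sets through `p` form a filter basis, and it contains every subbasic neighbourhood of
`p`. -/
theorem exists_isClopen_of_eventually {p : MSpec A} {P : MSpec A → Prop}
    (h : ∀ᶠ q in p.cnhds, P q) :
    ∃ U, @IsClopen _ (constructibleTopology (MSpec A)) U ∧ p ∈ U ∧ ∀ q ∈ U, P q := by
  let := constructibleTopology (MSpec A)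
  let F : FilterBasis (MSpec A) :=
    { sets := {U | IsClopen U ∧ p ∈ U}
      nonempty := ⟨Set.univ, isClopen_univ, Set.mem_univ p⟩
      inter_sets := fun {U V} hU hV =>
        ⟨U ∩ V, ⟨hU.1.inter hV.1, hU.2, hV.2⟩, subset_rfl⟩ }
  have hF : F.filter ≤ p.cnhds := by
    refine le_cnhds (fun a ha => ?_) fun a ha => ?_
    · exact FilterBasis.mem_filter_iff _ |>.2
        ⟨_, ⟨isClopen_basicOpenSet a, ha⟩, subset_rfl⟩
    · exact FilterBasis.mem_filter_iff _ |>.2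
        ⟨_, ⟨(isClopen_basicOpenSet a).compl, not_not.2 ha⟩, fun q hq => not_not.1 hq⟩
  obtain ⟨U, hU, h⟩ := (FilterBasis.mem_filter_iff _).1 (hF h)
  exact ⟨U, hU.1, hU.2, h⟩

theorem compactSpace_constructibleTopology :
    @CompactSpace (MSpec A) (constructibleTopology (MSpec A)) := by
  rw [constructibleTopology_eq]
  exact compactSpace_patchTopology

end Topology

/-! ### Residue hyperfields -/

variable {A : Type u} [MultiringOps A] [IsMultiring A]

theorem exists_frac (p : MSpec A) (ξ : p.K) :
    ∃ (x y : A) (hy : y ∉ p.carrier), ξ = p.frac x y hy := by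
  induction ξ using Localization.induction_on with | _ ξ =>
  obtain ⟨x, ⟨y, hy⟩⟩ := ξ
  obtain ⟨x, rfl⟩ := p.proj_surjective x
  obtain ⟨y, rfl⟩ := p.proj_surjective y
  exact ⟨x, y, fun h => hy (p.proj_eq_zero.2 h), rfl⟩

theorem frac_mul_frac (p : MSpec A) {x y z t : A} (hy : y ∉ p.carrier) (ht : t ∉ p.carrier) :
    p.frac x y hy * p.frac z t ht =
      p.frac (x * z) (y * t) (fun h => (p.mem_or_mem h).elim hy ht) :=
  Localization.mk_mul _ _ _ _

theorem frac_zero (p : MSpec A) {y : A} (hy : y ∉ p.carrier) : p.frac 0 y hy = 0 :=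
  Localization.mk_zero _

theorem frac_self (p : MSpec A) {y : A} (hy : y ∉ p.carrier) : p.frac y y hy = 1 :=
  Localization.mk_self (⟨p.proj y, _⟩ : nonzeroElements p.toMIdeal.Quo)

theorem neg_frac (p : MSpec A) {x y : A} (hy : y ∉ p.carrier) :
    -p.frac x y hy = p.frac (-x) y hy := rfl

/-- Membership of a fraction in a sum of fractions, witnessed by finitely many elements of `A`. -/
theorem frac_mem_hadd_iff (p : MSpec A) {x y z s t r : A} (hs : s ∉ p.carrier)
    (ht : t ∉ p.carrier) (hr : r ∉ p.carrier) :
    p.frac x s hs ∈ p.frac y t ht +ₕ p.frac z r hr ↔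
      ∃ v a b c i j k : A, v ∉ p.carrier ∧ i ∈ p.carrier ∧ j ∈ p.carrier ∧ k ∈ p.carrier ∧
        i ∈ a +ₕ -(x * t * r * v) ∧ j ∈ b +ₕ -(y * s * r * v) ∧ k ∈ c +ₕ -(z * s * t * v) ∧
        a ∈ b +ₕ c := by
  refine Localization.mk_mem_hadd_iff.trans ?_
  constructor
  · rintro ⟨⟨v, hv⟩, a, b, c, ha, hb, hc, h⟩
    obtain ⟨v, rfl⟩ := p.proj_surjective v
    obtain ⟨i, hi, ha⟩ := p.toMIdeal.proj_eq_proj.1 ha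
    obtain ⟨j, hj, hb⟩ := p.toMIdeal.proj_eq_proj.1 hb
    obtain ⟨k, hk, hc⟩ := p.toMIdeal.proj_eq_proj.1 hc
    exact ⟨v, a, b, c, i, j, k, fun h => hv (p.proj_eq_zero.2 h), hi, hj, hk, ha, hb, hc, h⟩
  · rintro ⟨v, a, b, c, i, j, k, hv, hi, hj, hk, ha, hb, hc, h⟩
    exact ⟨⟨p.proj v, fun h => hv (p.proj_eq_zero.1 h)⟩, a, b, c,
      p.toMIdeal.proj_eq_proj.2 ⟨i, hi, ha⟩, p.toMIdeal.proj_eq_proj.2 ⟨j, hj, hb⟩,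
      p.toMIdeal.proj_eq_proj.2 ⟨k, hk, hc⟩, h⟩

/-- The witnesses at `p` serve at every prime that contains `i`, `j`, `k` and omits `v`, and these
primes form a neighbourhood of `p`. -/
theorem eventually_frac_mem_hadd {p : MSpec A} {x y z s t r : A} {hs : s ∉ p.carrier}
    {ht : t ∉ p.carrier} {hr : r ∉ p.carrier}
    (h : p.frac x s hs ∈ p.frac y t ht +ₕ p.frac z r hr) :
    ∀ᶠ q in p.cnhds, ∀ (hs : s ∉ q.carrier) (ht : t ∉ q.carrier) (hr : r ∉ q.carrier),
      q.frac x s hs ∈ q.frac y t ht +ₕ q.frac z r hr := by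
  obtain ⟨v, a, b, c, i, j, k, hv, hi, hj, hk, h⟩ := (p.frac_mem_hadd_iff _ _ _).1 h
  filter_upwards [eventually_notMem hv, eventually_mem hi, eventually_mem hj, eventually_mem hk]
    with q hv hi hj hk hs ht hr
  exact (q.frac_mem_hadd_iff _ _ _).2 ⟨v, a, b, c, i, j, k, hv, hi, hj, hk, h⟩

theorem frac_eq_zero_iff (p : MSpec A) {x y : A} (hy : y ∉ p.carrier) :
    p.frac x y hy = 0 ↔ x ∈ p.carrier := by
  constructor
  · intro h
    replace h := h.trans (Localization.mk_zero (⟨p.proj y, fun h => hy (p.proj_eq_zero.1 h)⟩ :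
      nonzeroElements p.toMIdeal.Quo)).symm
    replace h := Localization.r_iff_exists.1 (Localization.mk_eq_mk_iff.1 h)
    obtain ⟨⟨v, hv⟩, h⟩ := h
    obtain ⟨v, rfl⟩ := p.proj_surjective v
    dsimp only at h
    rw [mul_zero, mul_zero, ← MIdeal.proj_mul, ← MIdeal.proj_mul, p.proj_eq_zero] at h
    have hv : v ∉ p.carrier := fun h => hv (p.proj_eq_zero.2 h)
    exact ((p.mem_or_mem h).resolve_left hv |> p.mem_or_mem).resolve_left hy
  · intro h
    refine Eq.trans ?_ (Localization.mk_zero (⟨p.proj y, fun h => hy (p.proj_eq_zero.1 h)⟩ :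
      nonzeroElements p.toMIdeal.Quo))
    exact congrArg (Localization.mk · _) (p.proj_eq_zero.2 h)

theorem K_one_ne_zero (p : MSpec A) : (1 : p.K) ≠ 0 := by
  rw [← p.frac_self p.one_notMem, Ne, frac_eq_zero_iff]
  exact p.one_notMem

theorem K_exists_inv (p : MSpec A) {ξ : p.K} (h : ξ ≠ 0) : ∃ η : p.K, ξ * η = 1 := by
  obtain ⟨x, y, hy, rfl⟩ := p.exists_frac ξ
  rw [Ne, frac_eq_zero_iff] at h
  refine ⟨p.frac y x h, ?_⟩
  rw [frac_mul_frac]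
  simp only [mul_comm x y]
  exact p.frac_self _

theorem K_mul_ne_zero (p : MSpec A) {ξ η : p.K} (hξ : ξ ≠ 0) (hη : η ≠ 0) : ξ * η ≠ 0 := by
  obtain ⟨ζ, hζ⟩ := p.K_exists_inv hξ
  intro h
  refine hη ?_
  rw [← one_mul η, ← hζ, mul_right_comm, h, zero_mul]

theorem K_mul_left_cancel (p : MSpec A) {ξ η ζ : p.K} (hξ : ξ ≠ 0) (h : ξ * η = ξ * ζ) :
    η = ζ := by
  obtain ⟨θ, hθ⟩ := p.K_exists_inv hξ
  rw [← one_mul η, ← one_mul ζ, ← hθ, mul_right_comm, h, mul_right_comm]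

/-- A nonzero factor is invertible and can be divided out; for the factor zero the sum is `{0}`, and
any element of `b + c` will do. -/
theorem isHyperring_K (p : MSpec A) : IsHyperring p.K := by
  intro b c d x hx
  by_cases hd : d = 0
  · subst hd
    obtain ⟨a, ha⟩ := IsMultiring.nonempty b c
    rw [mul_zero, mul_zero, IsMultiring.mem_add_zero] at hx
    exact ⟨a, ha, by rw [hx, mul_zero]⟩
  · obtain ⟨η, hη⟩ := p.K_exists_inv hd
    have := IsMultiring.mul_mem η hx
    rw [mul_assoc, mul_assoc, hη, mul_one, mul_one] at this
    exact ⟨_, this, by rw [mul_assoc, mul_comm η, hη, mul_one]⟩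

theorem frac_mul_frac_one (p : MSpec A) {x y : A} (hy : y ∉ p.carrier) :
    p.frac x y hy * p.frac y 1 p.one_notMem = p.frac x 1 p.one_notMem := by
  have h : p.frac x 1 p.one_notMem = p.frac x 1 p.one_notMem * p.frac y y hy := by
    rw [frac_self, mul_one]
  rw [h, frac_mul_frac, frac_mul_frac]
  simp only [mul_comm]

end MSpec

/-! ### The hull is a geometric von Neumann hyperring -/

section Hull

variable {A : Type u} [MultiringOps A] [IsMultiring A]

theorem isConstructibleSection_iff {f : ∀ p : MSpec A, p.K} :
    IsConstructibleSection f ↔ ∀ p : MSpec A, ∃ x y : A,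
      ∀ᶠ q in p.cnhds, ∃ hy : q ∈ basicOpenSet y, f q = q.frac x y hy := by
  refine forall_congr' fun p => ⟨?_, ?_⟩
  · rintro ⟨U, x, y, hU, hc, hp, h⟩
    refine ⟨x, y, ?_⟩
    filter_upwards [MSpec.eventually_of_isClopen hc hp] with q hq using ⟨hU hq, h q hq⟩
  · rintro ⟨x, y, h⟩
    obtain ⟨U, hc, hp, hU⟩ := MSpec.exists_isClopen_of_eventually h
    exact ⟨U, x, y, fun q hq => (hU q hq).1, hc, hp, fun q hq => (hU q hq).2⟩

/-! ### Local behaviour and gluing of constructible sections -/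

namespace VHull

@[ext]
theorem ext {f g : VHull A} (h : ∀ p, f.1 p = g.1 p) : f = g := Subtype.ext (funext h)

theorem mem_hadd_iff {f g h : VHull A} : f ∈ g +ₕ h ↔ ∀ p, f.1 p ∈ g.1 p +ₕ h.1 p := Iff.rfl

theorem mul_apply (f g : VHull A) (p : MSpec A) : (f * g).1 p = f.1 p * g.1 p := rfl

theorem one_apply (p : MSpec A) : (1 : VHull A).1 p = 1 := rfl

theorem eventually_eq_frac (f : VHull A) (p : MSpec A) :
    ∃ x y : A, ∀ᶠ q in p.cnhds, ∃ hy : q ∈ basicOpenSet y, f.1 q = q.frac x y hy :=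
  isConstructibleSection_iff.1 f.2 p

open Classical in
/-- The section that equals `f` on a clopen set and `g` on its complement. -/
noncomputable def piecewise (U : Set (MSpec A)) (hU : @IsClopen _ (constructibleTopology (MSpec A)) U)
    (f g : VHull A) : VHull A :=
  ⟨fun p => if p ∈ U then f.1 p else g.1 p, by
    refine isConstructibleSection_iff.2 fun p => ?_
    by_cases hp : p ∈ U
    · obtain ⟨x, y, h⟩ := f.eventually_eq_frac p
      refine ⟨x, y, ?_⟩
      filter_upwards [h, MSpec.eventually_of_isClopen hU hp] with q h hq
      rwa [if_pos hq]
    · obtain ⟨x, y, h⟩ := g.eventually_eq_frac p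
      refine ⟨x, y, ?_⟩
      filter_upwards [h, MSpec.eventually_of_isClopen
        (@IsClopen.compl _ (constructibleTopology (MSpec A)) _ hU) hp] with q h hq
      rwa [if_neg hq]⟩

theorem piecewise_of_mem {U : Set (MSpec A)}
    (hU : @IsClopen _ (constructibleTopology (MSpec A)) U) (f g : VHull A) {p : MSpec A}
    (hp : p ∈ U) : (piecewise U hU f g).1 p = f.1 p := if_pos hp

theorem piecewise_of_notMem {U : Set (MSpec A)}
    (hU : @IsClopen _ (constructibleTopology (MSpec A)) U) (f g : VHull A) {p : MSpec A}
    (hp : p ∉ U) : (piecewise U hU f g).1 p = g.1 p := if_neg hp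

/-- A fraction `x / y` extends by zero outside `D(y)`, which is clopen for the constructible
topology. -/
theorem exists_apply_eq (p : MSpec A) (ξ : p.K) : ∃ f : VHull A, f.1 p = ξ := by
  classical
  obtain ⟨x, y, hy, rfl⟩ := p.exists_frac ξ
  refine ⟨⟨fun q => if hq : y ∉ q.carrier then q.frac x y hq else 0,
    isConstructibleSection_iff.2 fun q => ?_⟩, dif_pos hy⟩
  by_cases hq : y ∈ q.carrier
  · refine ⟨0, 1, ?_⟩
    filter_upwards [MSpec.eventually_mem hq] with r hr
    exact ⟨r.one_notMem, by rw [dif_neg (not_not.2 hr), r.frac_zero]⟩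
  · refine ⟨x, y, ?_⟩
    filter_upwards [MSpec.eventually_notMem hq] with r hr using ⟨hr, dif_pos hr⟩

theorem eventually_mem_hadd {f g h : VHull A} {p : MSpec A} (hp : f.1 p ∈ g.1 p +ₕ h.1 p) :
    ∀ᶠ q in p.cnhds, f.1 q ∈ g.1 q +ₕ h.1 q := by
  obtain ⟨x, s, hf⟩ := f.eventually_eq_frac p
  obtain ⟨y, t, hg⟩ := g.eventually_eq_frac p
  obtain ⟨z, r, hh⟩ := h.eventually_eq_frac p
  obtain ⟨hs, hfp⟩ := hf.self_of_cnhds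
  obtain ⟨ht, hgp⟩ := hg.self_of_cnhds
  obtain ⟨hr, hhp⟩ := hh.self_of_cnhds
  rw [hfp, hgp, hhp] at hp
  filter_upwards [hf, hg, hh, MSpec.eventually_frac_mem_hadd hp] with q hf hg hh H
  obtain ⟨hs, hf⟩ := hf
  obtain ⟨ht, hg⟩ := hg
  obtain ⟨hr, hh⟩ := hh
  rw [hf, hg, hh]
  exact H hs ht hr

/-- Equality is membership in `g + 0`, hence also an open condition. -/
theorem eventually_eq {f g : VHull A} {p : MSpec A} (hp : f.1 p = g.1 p) :
    ∀ᶠ q in p.cnhds, f.1 q = g.1 q := by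
  have h : f.1 p ∈ g.1 p +ₕ (0 : VHull A).1 p := IsMultiring.mem_add_zero.2 hp
  filter_upwards [eventually_mem_hadd h] with q hq using IsMultiring.mem_add_zero.1 hq

/-- Being nonzero in a hyperfield means being invertible, and an equation `f * g = 1` at `p`
persists nearby. -/
theorem eventually_ne_zero {f : VHull A} {p : MSpec A} (hp : f.1 p ≠ 0) :
    ∀ᶠ q in p.cnhds, f.1 q ≠ 0 := by
  obtain ⟨ξ, hξ⟩ := p.K_exists_inv hp
  obtain ⟨g, rfl⟩ := exists_apply_eq p ξ
  filter_upwards [eventually_eq (f := f * g) (g := 1) hξ] with q hq h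
  refine q.K_one_ne_zero ?_
  rw [← one_apply, ← hq, mul_apply, h, zero_mul]

/-- Sections that solve a problem locally can be glued to a global solution, since the
constructible topology is compact and has a basis of clopen sets. -/
theorem exists_forall_of_eventually {R : ∀ p : MSpec A, p.K → Prop}
    (h : ∀ p : MSpec A, ∃ f : VHull A, ∀ᶠ q in p.cnhds, R q (f.1 q)) :
    ∃ f : VHull A, ∀ p, R p (f.1 p) := by
  have hc : @IsCompact (MSpec A) (constructibleTopology (MSpec A)) Set.univ :=
    @isCompact_univ _ (constructibleTopology (MSpec A)) MSpec.compactSpace_constructibleTopology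
  obtain ⟨U, -, hU, f, hf⟩ := @IsCompact.induction_on _ (constructibleTopology (MSpec A)) _ hc
    (fun s => ∃ U, @IsClopen _ (constructibleTopology (MSpec A)) U ∧ s ⊆ U ∧
      ∃ f : VHull A, ∀ p ∈ U, R p (f.1 p))
    ⟨∅, @isClopen_empty _ (constructibleTopology (MSpec A)), subset_rfl, 0, by simp⟩
    (by
      rintro s t hst ⟨U, hU, htU, h⟩
      exact ⟨U, hU, hst.trans htU, h⟩)
    (by
      rintro s t ⟨U, hU, hsU, f, hf⟩ ⟨V, hV, htV, g, hg⟩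
      refine ⟨U ∪ V, @IsClopen.union _ (constructibleTopology (MSpec A)) _ _ hU hV,
        Set.union_subset_union hsU htV, piecewise U hU f g, fun p hp => ?_⟩
      by_cases hpU : p ∈ U
      · rw [piecewise_of_mem _ _ _ hpU]
        exact hf p hpU
      · rw [piecewise_of_notMem _ _ _ hpU]
        exact hg p (hp.resolve_left hpU))
    (by
      intro p _
      obtain ⟨f, hf⟩ := h p
      obtain ⟨U, hU, hp, hfU⟩ := MSpec.exists_isClopen_of_eventually hf
      exact ⟨U, @mem_nhdsWithin_of_mem_nhds _ (constructibleTopology (MSpec A)) _ _ _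
        (MSpec.eventually_of_isClopen hU hp), U, hU, subset_rfl, f, hfU⟩)
  exact ⟨f, fun p => hf p (hU (Set.mem_univ p))⟩

/-- Only nonemptiness of sums and associativity assert existence; they are solved at each prime and
glued. The other axioms hold pointwise. -/
instance : IsMultiring (VHull A) where
  nonempty f g := exists_forall_of_eventually (R := fun p ξ => ξ ∈ f.1 p +ₕ g.1 p) fun p => by
    obtain ⟨ξ, hξ⟩ := IsMultiring.nonempty (f.1 p) (g.1 p)
    obtain ⟨h, rfl⟩ := exists_apply_eq p ξ
    exact ⟨h, eventually_mem_hadd hξ⟩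
  rev_left h p := IsMultiring.rev_left (h p)
  rev_right h p := IsMultiring.rev_right (h p)
  mem_add_zero {f g} :=
    ⟨fun h => ext fun p => IsMultiring.mem_add_zero.1 (h p),
      fun h p => IsMultiring.mem_add_zero.2 (congrArg (fun f : VHull A => f.1 p) h)⟩
  assoc {a b c g x} hx hg := by
    obtain ⟨h, hh⟩ := exists_forall_of_eventually
      (R := fun p ξ => ξ ∈ b.1 p +ₕ c.1 p ∧ x.1 p ∈ a.1 p +ₕ ξ) fun p => by
        obtain ⟨ξ, hξ, hξ'⟩ := IsMultiring.assoc (hx p) (hg p)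
        obtain ⟨h, rfl⟩ := exists_apply_eq p ξ
        exact ⟨h, (eventually_mem_hadd hξ).and (eventually_mem_hadd hξ')⟩
    exact ⟨h, fun p => (hh p).1, fun p => (hh p).2⟩
  comm f g := by
    ext h
    simp only [mem_hadd_iff, IsMultiring.comm]
  mul_mem d h p := IsMultiring.mul_mem (d.1 p) (h p)

theorem isVonNeumannHyperring : IsVonNeumannHyperring (VHull A) := by
  refine ⟨fun b c d x hx => ?_, fun a => ?_⟩
  · obtain ⟨a, ha⟩ := exists_forall_of_eventually
      (R := fun p ξ => ξ ∈ b.1 p +ₕ c.1 p ∧ x.1 p = ξ * d.1 p) fun p => by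
        obtain ⟨ξ, hξ, hξ'⟩ := p.isHyperring_K _ _ _ _ (hx p)
        obtain ⟨a, rfl⟩ := exists_apply_eq p ξ
        exact ⟨a, (eventually_mem_hadd hξ).and (eventually_eq (g := a * d) hξ')⟩
    exact ⟨a, fun p => (ha p).1, ext fun p => (ha p).2⟩
  · obtain ⟨b, hb⟩ := exists_forall_of_eventually
      (R := fun p ξ => a.1 p = a.1 p * a.1 p * ξ) fun p => by
        obtain ⟨ξ, hξ⟩ : ∃ ξ : p.K, a.1 p = a.1 p * a.1 p * ξ := by
          by_cases ha : a.1 p = 0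
          · exact ⟨0, by rw [ha, mul_zero]⟩
          · obtain ⟨ξ, hξ⟩ := p.K_exists_inv ha
            exact ⟨ξ, by rw [mul_assoc, hξ, mul_one]⟩
        obtain ⟨b, rfl⟩ := exists_apply_eq p ξ
        exact ⟨b, eventually_eq (g := a * a * b) hξ⟩
    exact ⟨b, by rw [sq]; exact ext hb⟩

/-- The prime ideal of sections that vanish at `p`. -/
def vanishingPrime (p : MSpec A) : MSpec (VHull A) where
  carrier := {f | f.1 p = 0}
  zero_mem := rfl
  add_mem {a b c} ha hb h := by
    have := h p
    rw [show a.1 p = 0 from ha, show b.1 p = 0 from hb, IsMultiring.mem_add_zero] at this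
    exact this
  mul_mem a b hb := by
    change a.1 p * b.1 p = 0
    rw [show b.1 p = 0 from hb, mul_zero]
  one_notMem := p.K_one_ne_zero
  mem_or_mem {a b} h := by
    by_contra! hab
    exact p.K_mul_ne_zero hab.1 hab.2 h

end VHull

/-! ### The structural presheaf of the hull -/

theorem notMem_of_mem_powerDivisors {a s : A} (hs : s ∈ powerDivisors a) {p : MSpec A}
    (hp : p ∈ basicOpenSet a) : s ∉ p.carrier := by
  obtain ⟨n, hn⟩ := hs
  exact fun h => MSpec.pow_notMem hp n (hn p.toMIdeal (by simpa using h))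

theorem mem_powerDivisors_self (a : A) : a ∈ powerDivisors a :=
  ⟨1, by rw [pow_one]; exact MIdeal.mem_span_self a⟩

theorem presheafRes_mk {a b : A} (h : basicOpenSet b ⊆ basicOpenSet a) (x : A)
    (s : powerDivisors a) :
    presheafRes h (Localization.mk x s) = Localization.mk x ⟨s, powerDivisors_le h s.2⟩ := rfl

theorem presheafSections.exists_mk {a : A} (x : presheafSections a) :
    ∃ (y : A) (s : powerDivisors a), x = Localization.mk y s := by
  induction x using Localization.induction_on with | _ x => exact ⟨x.1, x.2, rfl⟩

theorem presheafSections.mk_eq_mk_iff {e a b : A} {s t : powerDivisors e} :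
    (Localization.mk a s : presheafSections e) = Localization.mk b t ↔
      ∃ v ∈ powerDivisors e, v * (t * a) = v * (s * b) := by
  rw [Localization.mk_eq_mk_iff, Localization.r_iff_exists]
  simp

namespace VHull

theorem apply_ne_zero_of_mem_powerDivisors {e s : VHull A} (hs : s ∈ powerDivisors e)
    {p : MSpec A} (hp : e.1 p ≠ 0) : s.1 p ≠ 0 :=
  notMem_of_mem_powerDivisors hs (p := vanishingPrime p) hp

/-- Members of `S_e` vanish nowhere on the support of `e`, so they cancel there. Conversely `e ∈
S_e` serves as multiplier and kills both sides off the support. -/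
theorem presheaf_mk_eq_mk_iff {e a b : VHull A} {s t : powerDivisors e} :
    (Localization.mk a s : presheafSections e) = Localization.mk b t ↔
      ∀ p, e.1 p ≠ 0 → t.1.1 p * a.1 p = s.1.1 p * b.1 p := by
  rw [presheafSections.mk_eq_mk_iff]
  constructor
  · rintro ⟨v, hv, h⟩ p hp
    exact p.K_mul_left_cancel (apply_ne_zero_of_mem_powerDivisors hv hp)
      (congrArg (fun f : VHull A => f.1 p) h)
  · intro h
    refine ⟨e, mem_powerDivisors_self e, ext fun p => ?_⟩
    by_cases hp : e.1 p = 0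
    · simp only [mul_apply, hp, zero_mul]
    · simp only [mul_apply, h p hp]

theorem presheaf_mk_mem_hadd_iff {e a b c : VHull A} {s t r : powerDivisors e} :
    (Localization.mk a s : presheafSections e) ∈ Localization.mk b t +ₕ Localization.mk c r ↔
      ∀ p, e.1 p ≠ 0 →
        a.1 p * t.1.1 p * r.1.1 p ∈ b.1 p * s.1.1 p * r.1.1 p +ₕ c.1 p * s.1.1 p * t.1.1 p := by
  rw [Localization.mk_mem_hadd_iff]
  constructor
  · rintro ⟨v, h⟩ p hp
    obtain ⟨η, hη⟩ := p.K_exists_inv (apply_ne_zero_of_mem_powerDivisors v.2 hp)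
    have := IsMultiring.mul_mem η (h p)
    simpa only [mul_apply, mul_assoc, hη, mul_one] using this
  · intro h
    refine ⟨⟨e, mem_powerDivisors_self e⟩, fun p => ?_⟩
    by_cases hp : e.1 p = 0
    · simp only [mul_apply, hp, mul_zero]
      exact IsMultiring.self_mem 0
    · exact IsMultiring.mul_mem (e.1 p) (h p hp)

theorem exists_ne_zero_of_cover {e : VHull A} {ι : Type*} {c : ι → VHull A}
    (hc : basicOpenSet e = ⋃ i, basicOpenSet (c i)) {p : MSpec A} (hp : e.1 p ≠ 0) :
    ∃ i, (c i).1 p ≠ 0 := by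
  have h : vanishingPrime p ∈ basicOpenSet e := hp
  rw [hc, Set.mem_iUnion] at h
  exact h

theorem isMonoMultiring : IsMonoMultiring (VHull A) := by
  intro e ι c hc x y z h
  obtain ⟨a, s, rfl⟩ := x.exists_mk
  obtain ⟨b, t, rfl⟩ := y.exists_mk
  obtain ⟨d, r, rfl⟩ := z.exists_mk
  refine presheaf_mk_mem_hadd_iff.2 fun p hp => ?_
  obtain ⟨i, hi⟩ := exists_ne_zero_of_cover hc hp
  exact presheaf_mk_mem_hadd_iff.1 (h i) p hi

theorem isGeometric : IsGeometric (VHull A) := by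
  refine ⟨isMonoMultiring, fun e ι c hc x hx => ?_⟩
  choose a s hxs using fun i => (x i).exists_mk
  obtain rfl : x = fun i => Localization.mk (a i) (s i) := funext hxs
  have compat : ∀ i j p, (c i).1 p ≠ 0 → (c j).1 p ≠ 0 →
      (s j).1.1 p * (a i).1 p = (s i).1.1 p * (a j).1 p := fun i j p hi hj =>
    presheaf_mk_eq_mk_iff.1 (hx i j) p (p.K_mul_ne_zero hi hj)
  obtain ⟨f, hf⟩ := exists_forall_of_eventually
    (R := fun p ξ => ∀ i, (c i).1 p ≠ 0 → (a i).1 p = (s i).1.1 p * ξ) fun p => by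
      by_cases hp : ∃ i, (c i).1 p ≠ 0
      · obtain ⟨i, hi⟩ := hp
        -- Near `p` the solution is `a i / s i`, with the inverse of `s i` realised by a section
        -- `g`; compatibility carries it over to every other index `j`.
        have hsi := apply_ne_zero_of_mem_powerDivisors (s i).2 hi
        obtain ⟨η, hη⟩ := p.K_exists_inv hsi
        obtain ⟨g, rfl⟩ := exists_apply_eq p η
        refine ⟨a i * g, ?_⟩
        filter_upwards [eventually_ne_zero hi, eventually_ne_zero hsi,
          eventually_eq (f := (s i).1 * g) (g := 1) hη] with q hi hsi hg j hj
        replace hg : (s i).1.1 q * g.1 q = 1 := hg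
        rw [mul_apply, ← mul_assoc, compat i j q hi hj, mul_right_comm, hg, one_mul]
      -- If no `c i` is nonzero at `p`, then `e` vanishes at `p`, hence nearby, so all `c i` vanish
      -- nearby and the condition is vacuous.
      · have he : e.1 p = (0 : VHull A).1 p := by
          by_contra h
          exact hp (exists_ne_zero_of_cover hc h)
        refine ⟨0, ?_⟩
        filter_upwards [eventually_eq he] with q hq i hi
        exact absurd hq (basicOpenSet_subset_of_cover hc i
          (show vanishingPrime q ∈ basicOpenSet (c i) from hi))
  refine ⟨Localization.mk f 1, fun i => ?_⟩
  rw [presheafRes_mk, presheaf_mk_eq_mk_iff]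
  intro p hp
  refine (hf p i hp).symm.trans ?_
  exact (one_mul _).symm

theorem isGvNH : IsGvNH (VHull A) := ⟨isVonNeumannHyperring, isGeometric⟩

end VHull

end Hull

/-! ### Functoriality of the hull -/

section Functoriality

variable {A : Type u} {B : Type w} [MultiringOps A] [MultiringOps B]

/-- The preimage of a prime ideal under a morphism. -/
def MSpec.comap (f : MultiringHom A B) (q : MSpec B) : MSpec A where
  carrier := {a | f.toFun a ∈ q.carrier}
  zero_mem := by
    change f.toFun 0 ∈ q.carrier
    rw [f.map_zero]
    exact q.toMIdeal.zero_mem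
  add_mem ha hb h := q.add_mem ha hb (f.map_hadd h)
  mul_mem a b hb := by
    change f.toFun (a * b) ∈ q.carrier
    rw [f.map_mul]
    exact q.mul_mem _ hb
  one_notMem := by
    change f.toFun 1 ∉ q.carrier
    rw [f.map_one]
    exact q.one_notMem
  mem_or_mem {a b} h := by
    change f.toFun (a * b) ∈ q.carrier at h
    rw [f.map_mul] at h
    exact q.mem_or_mem h

theorem MSpec.tendsto_comap (f : MultiringHom A B) (q : MSpec B) :
    Tendsto (MSpec.comap f) q.cnhds (q.comap f).cnhds :=
  MSpec.le_cnhds (p := q.comap f) (F := map (MSpec.comap f) q.cnhds)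
    (fun _ ha => MSpec.eventually_notMem (p := q) ha)
    (fun _ ha => MSpec.eventually_mem (p := q) ha)

variable [IsMultiring A] [IsMultiring B]

/-- The image under `f` of a witness at the preimage of `q` is a witness at `q`. -/
theorem MSpec.frac_mem_hadd_of_comap (f : MultiringHom A B) (q : MSpec B) {x y z s t r : A}
    {hs : s ∉ (q.comap f).carrier} {ht : t ∉ (q.comap f).carrier} {hr : r ∉ (q.comap f).carrier}
    (h : (q.comap f).frac x s hs ∈ (q.comap f).frac y t ht +ₕ (q.comap f).frac z r hr) :
    q.frac (f.toFun x) (f.toFun s) hs ∈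
      q.frac (f.toFun y) (f.toFun t) ht +ₕ q.frac (f.toFun z) (f.toFun r) hr := by
  obtain ⟨v, a, b, c, i, j, k, hv, hi, hj, hk, h₁, h₂, h₃, h₄⟩ :=
    ((q.comap f).frac_mem_hadd_iff _ _ _).1 h
  refine (q.frac_mem_hadd_iff _ _ _).2 ⟨f.toFun v, f.toFun a, f.toFun b, f.toFun c, f.toFun i,
    f.toFun j, f.toFun k, hv, hi, hj, hk, ?_, ?_, ?_, f.map_hadd h₄⟩
  · simpa only [f.map_neg, f.map_mul] using f.map_hadd h₁
  · simpa only [f.map_neg, f.map_mul] using f.map_hadd h₂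
  · simpa only [f.map_neg, f.map_mul] using f.map_hadd h₃

theorem MSpec.frac_eq_of_comap (f : MultiringHom A B) (q : MSpec B) {x y s t : A}
    {hs : s ∉ (q.comap f).carrier} {ht : t ∉ (q.comap f).carrier}
    (h : (q.comap f).frac x s hs = (q.comap f).frac y t ht) :
    q.frac (f.toFun x) (f.toFun s) hs = q.frac (f.toFun y) (f.toFun t) ht := by
  have h' := IsMultiring.mem_add_zero.2 h
  rw [← (q.comap f).frac_zero ht] at h'
  have := q.frac_mem_hadd_of_comap f h'
  simp only [f.map_zero] at this
  rwa [show q.frac 0 (f.toFun t) ht = 0 from q.frac_zero ht, IsMultiring.mem_add_zero] at this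

/-- The map on residue hyperfields induced by a morphism. -/
noncomputable def MSpec.kMap (f : MultiringHom A B) (q : MSpec B) (ξ : (q.comap f).K) : q.K :=
  q.frac (f.toFun ((q.comap f).exists_frac ξ).choose)
    (f.toFun ((q.comap f).exists_frac ξ).choose_spec.choose)
    ((q.comap f).exists_frac ξ).choose_spec.choose_spec.choose

/-- The value does not depend on the fraction chosen in `MSpec.kMap`. -/
theorem MSpec.kMap_frac (f : MultiringHom A B) (q : MSpec B) (x y : A)
    (hy : y ∉ (q.comap f).carrier) :
    q.kMap f ((q.comap f).frac x y hy) = q.frac (f.toFun x) (f.toFun y) hy :=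
  q.frac_eq_of_comap f ((q.comap f).exists_frac _).choose_spec.choose_spec.choose_spec.symm

/-- The morphism `V(f)`. -/
noncomputable def hullMap (f : MultiringHom A B) : MultiringHom (VHull A) (VHull B) where
  toFun s := ⟨fun q => q.kMap f (s.1 (q.comap f)), by
    refine isConstructibleSection_iff.2 fun q => ?_
    obtain ⟨x, y, h⟩ := s.eventually_eq_frac (q.comap f)
    refine ⟨f.toFun x, f.toFun y, ?_⟩
    filter_upwards [MSpec.tendsto_comap f q |>.eventually h] with r ⟨hy, hr⟩
    exact ⟨hy, by rw [hr]; exact r.kMap_frac f x y hy⟩⟩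
  map_hadd {a b c} h q := by
    have h := h (q.comap f)
    change q.kMap f (a.1 (q.comap f)) ∈ q.kMap f (b.1 (q.comap f)) +ₕ q.kMap f (c.1 (q.comap f))
    obtain ⟨x, s, hs, hx⟩ := (q.comap f).exists_frac (a.1 (q.comap f))
    obtain ⟨y, t, ht, hy⟩ := (q.comap f).exists_frac (b.1 (q.comap f))
    obtain ⟨z, r, hr, hz⟩ := (q.comap f).exists_frac (c.1 (q.comap f))
    rw [hx, hy, hz] at h ⊢
    rw [MSpec.kMap_frac, MSpec.kMap_frac, MSpec.kMap_frac]
    exact q.frac_mem_hadd_of_comap f h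
  map_mul a b := VHull.ext fun q => by
    change q.kMap f (a.1 (q.comap f) * b.1 (q.comap f)) =
      q.kMap f (a.1 (q.comap f)) * q.kMap f (b.1 (q.comap f))
    obtain ⟨x, s, hs, hx⟩ := (q.comap f).exists_frac (a.1 (q.comap f))
    obtain ⟨y, t, ht, hy⟩ := (q.comap f).exists_frac (b.1 (q.comap f))
    rw [hx, hy, MSpec.frac_mul_frac, MSpec.kMap_frac, MSpec.kMap_frac, MSpec.kMap_frac]
    refine Eq.trans ?_ (q.frac_mul_frac (y := f.toFun s) (t := f.toFun t) hs ht).symm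
    simp only [f.map_mul]
  map_zero := VHull.ext fun q => by
    change q.kMap f 0 = 0
    rw [← (q.comap f).frac_zero (q.comap f).one_notMem, MSpec.kMap_frac]
    simp only [f.map_zero]
    exact q.frac_zero _
  map_one := VHull.ext fun q => by
    change q.kMap f 1 = 1
    rw [← (q.comap f).frac_self (q.comap f).one_notMem, MSpec.kMap_frac]
    exact q.frac_self _
  map_neg a := VHull.ext fun q => by
    change q.kMap f (-a.1 (q.comap f)) = -q.kMap f (a.1 (q.comap f))
    obtain ⟨x, s, hs, hx⟩ := (q.comap f).exists_frac (a.1 (q.comap f))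
    rw [hx, MSpec.neg_frac, MSpec.kMap_frac, MSpec.kMap_frac]
    simp only [f.map_neg]
    rfl

theorem hullMap_comp_toVHull (f : MultiringHom A B) :
    (hullMap f).comp (toVHull A) = (toVHull B).comp f := by
  refine MultiringHom.ext (funext fun a => VHull.ext fun q => ?_)
  refine (q.kMap_frac f a 1 (q.comap f).one_notMem).trans ?_
  change q.frac (f.toFun a) (f.toFun 1) _ = q.frac (f.toFun a) 1 q.one_notMem
  simp only [f.map_one]

end Functoriality

/-! ### Von Neumann hyperrings -/

section VonNeumann

variable {B : Type w} [MultiringOps B]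

theorem basicOpenSet_one_eq_iUnion {c : MSpec B → B} (hc : ∀ p, c p ∉ p.carrier) :
    basicOpenSet (1 : B) = ⋃ p, basicOpenSet (c p) :=
  Set.Subset.antisymm (fun p _ => Set.mem_iUnion.2 ⟨p, hc p⟩) fun p _ => p.one_notMem

variable [IsMultiring B]

/-- This replaces the complement `1 - ab` of the idempotent `ab`, where `a = a²b`: the multivalued
difference contains an element `t` that annihilates `a`. -/
theorem IsVonNeumannHyperring.exists_one_mem_hadd (hB : IsVonNeumannHyperring B) (a : B) :
    ∃ t u : B, 1 ∈ t +ₕ a * u ∧ t * a = 0 := by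
  obtain ⟨b, hb⟩ := hB.2 a
  have he : a * b * (a * b) = a * b := by
    conv_rhs => rw [hb]
    rw [sq]
    ac_rfl
  -- Full distributivity factors this zero as `t * (a * b)` with `t ∈ 1 - a * b`.
  have h : (0 : B) ∈ 1 * (a * b) +ₕ -(a * b) * (a * b) := by
    rw [one_mul, IsMultiring.neg_mul, he]
    exact IsMultiring.zero_mem _
  obtain ⟨t, ht, h0⟩ := hB.1 _ _ _ _ h
  refine ⟨t, b, ?_, ?_⟩
  · have := IsMultiring.rev_right ht
    rwa [IsMultiring.neg_neg] at this
  · calc t * a = t * (a ^ 2 * b) := by rw [← hb]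
      _ = t * (a * b) * a := by rw [sq]; ac_rfl
      _ = 0 := by rw [← h0, zero_mul]

theorem IsVonNeumannHyperring.exists_mul_eq_zero (hB : IsVonNeumannHyperring B) {p : MSpec B}
    {a : B} (ha : a ∈ p.carrier) : ∃ t ∉ p.carrier, t * a = 0 := by
  obtain ⟨t, u, h, h0⟩ := hB.exists_one_mem_hadd a
  refine ⟨t, fun ht => p.one_notMem (p.add_mem ht ?_ h), h0⟩
  rw [mul_comm]
  exact p.mul_mem u ha

/-- In a von Neumann hyperring the basic open sets form a basis of the constructible topology. -/
theorem IsVonNeumannHyperring.exists_basicOpenSet (hB : IsVonNeumannHyperring B) {p : MSpec B}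
    {P : MSpec B → Prop} (h : ∀ᶠ q in p.cnhds, P q) :
    ∃ e ∉ p.carrier, ∀ q ∈ basicOpenSet e, P q := by
  let F : Filter (MSpec B) :=
    { sets := {U | ∃ e ∉ p.carrier, basicOpenSet e ⊆ U}
      univ_sets := ⟨1, p.one_notMem, Set.subset_univ _⟩
      sets_of_superset := fun ⟨e, he, h⟩ hUV => ⟨e, he, h.trans hUV⟩
      inter_sets := fun ⟨e, he, h⟩ ⟨e', he', h'⟩ =>
        ⟨e * e', fun hp => (p.mem_or_mem hp).elim he he',
          Set.subset_inter ((basicOpenSet_mul_subset_left e e').trans h)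
            ((basicOpenSet_mul_subset_right e e').trans h')⟩ }
  have hF : F ≤ p.cnhds := by
    refine MSpec.le_cnhds (fun a ha => ⟨a, ha, subset_rfl⟩) fun a ha => ?_
    -- Since `t * a = 0`, every prime omitting `t` contains `a`: the set `D(t)` is a neighbourhood
    -- of `p` inside the complement of `D(a)`.
    obtain ⟨t, ht, h0⟩ := hB.exists_mul_eq_zero ha
    refine ⟨t, ht, fun q hq => ?_⟩
    refine (q.mem_or_mem (a := t) ?_).resolve_left hq
    rw [h0]
    exact q.toMIdeal.zero_mem
  exact hF h

/-- In a hyperring the multiples of `s` are closed under sums, so they already form an ideal, and `1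
∈ (s)` says that `s` is a unit. -/
theorem IsHyperring.exists_mul_eq_one (hB : IsHyperring B) {s : B}
    (hs : s ∈ powerDivisors (1 : B)) : ∃ u, s * u = 1 := by
  obtain ⟨n, hn⟩ := hs
  rw [one_pow] at hn
  obtain ⟨u, hu⟩ := hn
    { carrier := {x | ∃ u, x = u * s}
      zero_mem := ⟨0, (zero_mul s).symm⟩
      add_mem := by
        rintro _ _ c ⟨u, rfl⟩ ⟨v, rfl⟩ h
        obtain ⟨t, -, ht⟩ := hB _ _ _ _ h
        exact ⟨t, ht⟩
      mul_mem := by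
        rintro a _ ⟨u, rfl⟩
        exact ⟨a * u, (mul_assoc _ _ _).symm⟩ }
    (by
      rintro _ rfl
      exact ⟨1, (one_mul _).symm⟩)
  exact ⟨u, by rw [hu, mul_comm]⟩

theorem IsMultiring.mul_eq_mul_of_mem_hadd_neg {a b i e : B} (h : i ∈ a +ₕ -b) (hi : e * i = 0) :
    a * e = b * e := by
  have h' := IsMultiring.rev_right (IsMultiring.mul_mem e h)
  rw [mul_comm i, hi, IsMultiring.mem_zero_add, IsMultiring.neg_mul, IsMultiring.neg_neg] at h'
  exact h'

/-- The natural map of a geometric von Neumann hyperring to its hull reflects sums. -/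
theorem IsGvNH.mem_hadd_of_toVHull (hB : IsGvNH B) {x y z : B}
    (h : (toVHull B).toFun x ∈ (toVHull B).toFun y +ₕ (toVHull B).toFun z) : x ∈ y +ₕ z := by
  have key : ∀ p : MSpec B, ∃ e ∉ p.carrier, x * e ∈ y * e +ₕ z * e := by
    intro p
    obtain ⟨v, a, b, c, i, j, k, hv, hi, hj, hk, h₁, h₂, h₃, h₄⟩ :=
      (p.frac_mem_hadd_iff p.one_notMem p.one_notMem p.one_notMem).1 (h p)
    -- The errors `i`, `j`, `k` of the relation modulo `p` are annihilated by elements outside `p`;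
    -- multiplying by these turns it into a relation in `B`.
    obtain ⟨r, hr, hri⟩ := hB.1.exists_mul_eq_zero hi
    obtain ⟨s, hs, hsj⟩ := hB.1.exists_mul_eq_zero hj
    obtain ⟨t, ht, htk⟩ := hB.1.exists_mul_eq_zero hk
    have hn : r * s * t ∉ p.carrier := by
      simp only [p.mul_mem_iff, hr, hs, ht, or_self, not_false_eq_true]
    have hx := IsMultiring.mul_eq_mul_of_mem_hadd_neg (e := r * s * t) h₁ (by
      rw [show r * s * t * i = r * i * (s * t) by ac_rfl, hri, zero_mul])
    have hy := IsMultiring.mul_eq_mul_of_mem_hadd_neg (e := r * s * t) h₂ (by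
      rw [show r * s * t * j = s * j * (r * t) by ac_rfl, hsj, zero_mul])
    have hz := IsMultiring.mul_eq_mul_of_mem_hadd_neg (e := r * s * t) h₃ (by
      rw [show r * s * t * k = t * k * (r * s) by ac_rfl, htk, zero_mul])
    have := IsMultiring.mul_mem (r * s * t) h₄
    rw [hx, hy, hz] at this
    refine ⟨v * (r * s * t), fun hp => (p.mem_or_mem hp).elim hv hn, ?_⟩
    simpa only [mul_one, mul_assoc] using this
  choose e he hxyz using key
  -- The sets `D(e p)` cover `D(1)`, and `e p ∈ S_(e p)` is the multiplier that makes the relation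
  -- hold over `D(e p)`. The global relation then descends to `B` because `S_1` consists of units.
  have hm := hB.2.1 1 (MSpec B) e (basicOpenSet_one_eq_iUnion he)
    (Localization.mk x 1) (Localization.mk y 1) (Localization.mk z 1) fun p =>
      Localization.mk_mem_hadd_iff.2 ⟨⟨e p, mem_powerDivisors_self _⟩, by
        change x * 1 * 1 * e p ∈ y * 1 * 1 * e p +ₕ z * 1 * 1 * e p
        simpa only [mul_one] using hxyz p⟩
  obtain ⟨v, hv⟩ := Localization.mk_mem_hadd_iff.1 hm
  obtain ⟨u, hu⟩ := hB.1.1.exists_mul_eq_one v.2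
  have := IsMultiring.mul_mem u hv
  simpa only [Submonoid.coe_one, mul_one, mul_assoc, hu] using this

theorem IsGvNH.toVHull_injective (hB : IsGvNH B) : Function.Injective (toVHull B).toFun := by
  intro x y h
  refine IsMultiring.mem_add_zero.1 (hB.mem_hadd_of_toVHull ?_)
  rw [(toVHull B).map_zero]
  exact IsMultiring.mem_add_zero.2 h

theorem toVHull_apply_ne_zero {p : MSpec B} {a : B} (ha : a ∉ p.carrier) :
    ((toVHull B).toFun a).1 p ≠ 0 := fun h => ha ((p.frac_eq_zero_iff p.one_notMem).1 h)

theorem toVHull_apply_eq_zero {p : MSpec B} {a : B} (ha : a ∈ p.carrier) :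
    ((toVHull B).toFun a).1 p = 0 := (p.frac_eq_zero_iff p.one_notMem).2 ha

theorem toVHull_mul_apply (p : MSpec B) (a b : B) :
    ((toVHull B).toFun (a * b)).1 p = ((toVHull B).toFun a).1 p * ((toVHull B).toFun b).1 p := by
  rw [(toVHull B).map_mul, VHull.mul_apply]

/-- With `y = y²y'`, the element `y'` is inverse to `y` at every prime omitting `y`, so the fraction
`x / y` is the value of `x * y'`. -/
theorem IsVonNeumannHyperring.exists_eventually_eq (hB : IsVonNeumannHyperring B) (s : VHull B)
    (p : MSpec B) : ∃ u : B, ∃ e ∉ p.carrier, ∀ q ∈ basicOpenSet e,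
      s.1 q = ((toVHull B).toFun u).1 q := by
  obtain ⟨x, y, h⟩ := s.eventually_eq_frac p
  obtain ⟨e, he, h⟩ := hB.exists_basicOpenSet h
  obtain ⟨y', hy'⟩ := hB.2 y
  refine ⟨x * y', e, he, fun q hq => ?_⟩
  obtain ⟨hy, hs⟩ := h q hq
  refine q.K_mul_left_cancel (toVHull_apply_ne_zero hy) ?_
  rw [← toVHull_mul_apply, hs, mul_comm]
  refine (q.frac_mul_frac_one hy).trans (q.K_mul_left_cancel (toVHull_apply_ne_zero hy) ?_)
  refine (toVHull_mul_apply q y x).symm.trans (Eq.trans ?_ (toVHull_mul_apply q y _))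
  refine congrArg (fun a => ((toVHull B).toFun a).1 q) ?_
  conv_lhs => rw [hy', sq]
  ac_rfl

/-- A constructible section comes from elements `u p` of `B` on a cover of `D(1)` by sets `D(e p)`;
these are glued by the sheaf property. -/
theorem IsGvNH.toVHull_surjective (hB : IsGvNH B) : Function.Surjective (toVHull B).toFun := by
  intro s
  choose u e he hu using hB.1.exists_eventually_eq s
  obtain ⟨y, hy⟩ := hB.2.2 1 (MSpec B) e (basicOpenSet_one_eq_iUnion he)
    (fun p => Localization.mk (u p) 1) fun p q => by
      rw [presheafRes_mk, presheafRes_mk, presheafSections.mk_eq_mk_iff]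
      -- Multiplied by `e p * e q`, the two local elements agree at every prime: both become `s`
      -- times this factor on `D(e p * e q)` and zero elsewhere. Injectivity of `v_B` gives equality
      -- in `B`.
      refine ⟨e p * e q, mem_powerDivisors_self _, hB.toVHull_injective (VHull.ext fun r => ?_)⟩
      by_cases hr : e p * e q ∈ r.carrier
      · rw [toVHull_mul_apply r (e p * e q), toVHull_mul_apply r (e p * e q), toVHull_apply_eq_zero hr, zero_mul, zero_mul]
      · change ((toVHull B).toFun (e p * e q * (1 * u p))).1 r =
          ((toVHull B).toFun (e p * e q * (1 * u q))).1 r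
        rw [one_mul, one_mul, toVHull_mul_apply r (e p * e q), toVHull_mul_apply r (e p * e q),
          ← hu p r (basicOpenSet_mul_subset_left _ _ hr),
          ← hu q r (basicOpenSet_mul_subset_right _ _ hr)]
  obtain ⟨b, t, rfl⟩ := y.exists_mk
  obtain ⟨w, hw⟩ := hB.1.1.exists_mul_eq_one t.2
  refine ⟨b * w, VHull.ext fun p => ?_⟩
  have hp := hy p
  rw [presheafRes_mk, presheafSections.mk_eq_mk_iff] at hp
  obtain ⟨v, hv, h⟩ := hp
  replace h : v * (1 * b) = v * (t * u p) := h
  rw [one_mul] at h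
  rw [hu p p (he p)]
  refine p.K_mul_left_cancel (toVHull_apply_ne_zero (notMem_of_mem_powerDivisors hv (he p))) ?_
  rw [← toVHull_mul_apply, ← toVHull_mul_apply, ← mul_assoc, h]
  refine congrArg (fun a => ((toVHull B).toFun a).1 p) ?_
  calc v * (t * u p) * w = v * (t * w * u p) := by ac_rfl
    _ = v * u p := by rw [hw, one_mul]

end VonNeumann

/-! ### The universal property -/

section Universal

variable {A : Type u} {B : Type w} [MultiringOps A] [IsMultiring A] [MultiringOps B]
  [IsMultiring B]

/-- A local expression of `s` near the prime `p` cut out by `k` becomes a global equation after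
multiplication by a section supported where the expression is valid; such a section can be found
outside the kernel of `k`. -/
theorem MultiringHom.exists_mul_eq_of_eventually {F : Type*} [MultiringOps F] [IsMultiring F]
    [IsMultidomain F] (k : MultiringHom (VHull A) F) {p : MSpec A}
    (hp : ∀ a, a ∈ p.carrier ↔ k.toFun ((toVHull A).toFun a) = 0) (s : VHull A) {x y : A}
    (h : ∀ᶠ q in p.cnhds, ∃ hy : q ∈ basicOpenSet y, s.1 q = q.frac x y hy) :
    ∃ c : F, c ≠ 0 ∧ c * (k.toFun s * k.toFun ((toVHull A).toFun y)) =
      c * k.toFun ((toVHull A).toFun x) := by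
  -- A set is in `G` if some section not killed by `k` vanishes off it. Intersections correspond to
  -- products of sections, as `F` has no zero divisors.
  let G : Filter (MSpec A) :=
    { sets := {U | ∃ t : VHull A, k.toFun t ≠ 0 ∧ ∀ q ∉ U, t.1 q = 0}
      univ_sets := ⟨1, by rw [k.map_one]; exact IsMultidomain.one_ne_zero,
        fun q hq => absurd (Set.mem_univ q) hq⟩
      sets_of_superset := fun ⟨t, ht, h⟩ hUV => ⟨t, ht, fun q hq => h q fun hU => hq (hUV hU)⟩
      inter_sets := by
        rintro U V ⟨t, ht, h⟩ ⟨t', ht', h'⟩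
        refine ⟨t * t', ?_, fun q hq => ?_⟩
        · rw [k.map_mul]
          exact fun h => (IsMultidomain.eq_zero_or h).elim ht ht'
        · rw [VHull.mul_apply]
          by_cases hU : q ∈ U
          · rw [h' q fun hV => hq ⟨hU, hV⟩, mul_zero]
          · rw [h q hU, zero_mul] }
  have hG : G ≤ p.cnhds := by
    refine MSpec.le_cnhds (fun a ha => ?_) fun a ha => ?_
    · exact ⟨(toVHull A).toFun a, fun h0 => ha ((hp a).2 h0),
        fun q hq => toVHull_apply_eq_zero (not_not.1 hq)⟩
    -- As `k` kills the image of `a`, the relation `1 ∈ t + v(a) w` forces `k(t) = 1`, while `t *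
    -- v(a) = 0` confines `t` to the primes containing `a`.
    · obtain ⟨t, w, h1, h0⟩ :=
        VHull.isVonNeumannHyperring.exists_one_mem_hadd ((toVHull A).toFun a)
      refine ⟨t, ?_, fun q hq => ?_⟩
      · have := k.map_hadd h1
        rw [k.map_mul, (hp a).1 ha, zero_mul, IsMultiring.mem_add_zero, k.map_one] at this
        rw [← this]
        exact IsMultidomain.one_ne_zero
      · by_contra hne
        exact q.K_mul_ne_zero hne (toVHull_apply_ne_zero hq)
          (congrArg (fun f : VHull A => f.1 q) h0)
  obtain ⟨t, ht, h0⟩ := hG h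
  refine ⟨k.toFun t, ht, ?_⟩
  rw [← k.map_mul, ← k.map_mul, ← k.map_mul]
  congr 1
  refine VHull.ext fun q => ?_
  by_cases hq : ∃ hy : q ∈ basicOpenSet y, s.1 q = q.frac x y hy
  · obtain ⟨hy, hs⟩ := hq
    rw [VHull.mul_apply, VHull.mul_apply, VHull.mul_apply, hs]
    exact congrArg _ (q.frac_mul_frac_one hy)
  · rw [VHull.mul_apply t, VHull.mul_apply t, h0 q hq, zero_mul, zero_mul]

/-- Evaluation at a prime ideal. -/
def VHull.eval (q : MSpec B) : MultiringHom (VHull B) q.K where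
  toFun s := s.1 q
  map_hadd h := h q
  map_mul _ _ := rfl
  map_zero := rfl
  map_one := rfl
  map_neg _ := rfl

instance MSpec.isMultidomain_K (q : MSpec B) : IsMultidomain q.K where
  one_ne_zero := q.K_one_ne_zero
  eq_zero_or h := by
    by_contra! hne
    exact q.K_mul_ne_zero hne.1 hne.2 h

/-- The kernel of a morphism to a multidomain. -/
def MultiringHom.kerPrime {F : Type*} [MultiringOps F] [IsMultiring F] [IsMultidomain F]
    (k : MultiringHom A F) : MSpec A where
  carrier := {a | k.toFun a = 0}
  zero_mem := k.map_zero
  add_mem {a b c} ha hb h := by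
    have := k.map_hadd h
    rw [show k.toFun a = 0 from ha, show k.toFun b = 0 from hb, IsMultiring.mem_add_zero] at this
    exact this
  mul_mem a b hb := by
    change k.toFun (a * b) = 0
    rw [k.map_mul, show k.toFun b = 0 from hb, mul_zero]
  one_notMem := by
    change k.toFun 1 ≠ 0
    rw [k.map_one]
    exact IsMultidomain.one_ne_zero
  mem_or_mem {a b} h := by
    change k.toFun (a * b) = 0 at h
    rw [k.map_mul] at h
    exact IsMultidomain.eq_zero_or h

/-- After evaluation at `q`, both morphisms have the same kernel prime on `A`, and each sends `s` to
the quotient of the images of `x` and `y`, where `s` is `x / y` near that prime. -/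
theorem hull_hom_ext {g g' : MultiringHom (VHull A) (VHull B)}
    (h : g.comp (toVHull A) = g'.comp (toVHull A)) : g = g' := by
  refine MultiringHom.ext (funext fun s => VHull.ext fun q => ?_)
  have hv : ∀ a, g.toFun ((toVHull A).toFun a) = g'.toFun ((toVHull A).toFun a) := fun a =>
    congrArg (fun f : MultiringHom A (VHull B) => f.toFun a) h
  let k := (VHull.eval q).comp g
  let k' := (VHull.eval q).comp g'
  have hk : ∀ a, k.toFun ((toVHull A).toFun a) = k'.toFun ((toVHull A).toFun a) := fun a =>
    congrArg (fun f : VHull B => f.1 q) (hv a)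
  let p := (k.comp (toVHull A)).kerPrime
  have hp : ∀ a, a ∈ p.carrier ↔ k.toFun ((toVHull A).toFun a) = 0 := fun a => Iff.rfl
  obtain ⟨x, y, hs⟩ := s.eventually_eq_frac p
  obtain ⟨c, hc, e⟩ := k.exists_mul_eq_of_eventually hp s hs
  obtain ⟨c', hc', e'⟩ := k'.exists_mul_eq_of_eventually
    (fun a => by rw [hp, hk]) s hs
  have hy : k.toFun ((toVHull A).toFun y) ≠ 0 := hs.self_of_cnhds.choose
  have e := q.K_mul_left_cancel hc e
  have e' := q.K_mul_left_cancel hc' e'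
  rw [← hk, ← hk] at e'
  refine q.K_mul_left_cancel (ξ := k.toFun ((toVHull A).toFun y)) hy ?_
  rw [mul_comm, mul_comm (k.toFun _)]
  exact e.trans e'.symm

/-- The inverse of `v_B` for a geometric von Neumann hyperring `B`. -/
noncomputable def IsGvNH.retraction (hB : IsGvNH B) : MultiringHom (VHull B) B where
  toFun := Function.surjInv hB.toVHull_surjective
  map_hadd h := hB.mem_hadd_of_toVHull (by simpa only [Function.surjInv_eq] using h)
  map_mul a b := hB.toVHull_injective (by
    rw [(toVHull B).map_mul]
    simp only [Function.surjInv_eq])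
  map_zero := hB.toVHull_injective (by
    rw [(toVHull B).map_zero]
    simp only [Function.surjInv_eq])
  map_one := hB.toVHull_injective (by
    rw [(toVHull B).map_one]
    simp only [Function.surjInv_eq])
  map_neg a := hB.toVHull_injective (by
    rw [(toVHull B).map_neg]
    simp only [Function.surjInv_eq])

theorem IsGvNH.retraction_toVHull (hB : IsGvNH B) (b : B) :
    hB.retraction.toFun ((toVHull B).toFun b) = b :=
  hB.toVHull_injective (Function.surjInv_eq hB.toVHull_surjective _)

/-- The extension of a morphism to a geometric von Neumann hyperring. -/
noncomputable def hullLift (hB : IsGvNH B) (f : MultiringHom A B) : MultiringHom (VHull A) B :=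
  hB.retraction.comp (hullMap f)

theorem hullLift_comp_toVHull (hB : IsGvNH B) (f : MultiringHom A B) :
    (hullLift hB f).comp (toVHull A) = f := by
  refine MultiringHom.ext (funext fun a => ?_)
  refine Eq.trans ?_ (hB.retraction_toVHull (f.toFun a))
  exact congrArg (fun g : MultiringHom A (VHull B) => hB.retraction.toFun (g.toFun a))
    (hullMap_comp_toVHull f)

/-- The injectivity of `v_B` reduces this to morphisms between hulls. -/
theorem hull_hom_ext_of_isGvNH (hB : IsGvNH B) {g g' : MultiringHom (VHull A) B}
    (h : g.comp (toVHull A) = g'.comp (toVHull A)) : g = g' := by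
  have := hull_hom_ext (g := (toVHull B).comp g) (g' := (toVHull B).comp g')
    (congrArg (toVHull B).comp h)
  refine MultiringHom.ext (funext fun s => hB.toVHull_injective ?_)
  exact congrArg (fun f : MultiringHom (VHull A) (VHull B) => f.toFun s) this

end Universal

theorem mainTheorem2 :
    ∃ (hM : ∀ (A : Type u) [MultiringOps A] [IsMultiring A], IsMultiring (VHull A))
      (hG : ∀ (A : Type u) [MultiringOps A] [IsMultiring A], @IsGvNH (VHull A) _ (hM A)),
      -- every morphism extends uniquely to the hulls
      (∀ (A : Type u) (B : Type w) [MultiringOps A] [IsMultiring A] [MultiringOps B]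
        [IsMultiring B] (f : MultiringHom A B),
        ∃! g : MultiringHom (VHull A) (VHull B),
          g.comp (toVHull A) = (toVHull B).comp f) ∧
      -- the universal property
      (∀ (A : Type u) (B : Type w) [MultiringOps A] [IsMultiring A] [MultiringOps B]
        [IsMultiring B] (f : MultiringHom A B), IsGvNH B →
        ∃! g : MultiringHom (VHull A) B, g.comp (toVHull A) = f) ∧
      -- with these extensions `V` is a functor, left adjoint to the inclusion with unit `v`
      ∃ (map : ∀ {A B : MultiCat.{u}}, (A ⟶ B) →
          (A.hull (hM A.carrier) (hG A.carrier) ⟶ B.hull (hM B.carrier) (hG B.carrier)))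
        (map_id : ∀ A : MultiCat.{u}, map (𝟙 A) = 𝟙 (A.hull (hM A.carrier) (hG A.carrier)))
        (map_comp : ∀ {A B C : MultiCat.{u}} (f : A ⟶ B) (g : B ⟶ C),
          map (f ≫ g) = map f ≫ map g),
        (∀ (A B : MultiCat.{u}) (f : A ⟶ B),
          MultiringHom.comp (map f).hom (toVHull A.carrier) =
            MultiringHom.comp (toVHull B.carrier) f) ∧
        ∃ adj : ({ obj := fun A => A.hull (hM A.carrier) (hG A.carrier)
                   map := map
                   map_id := map_id
                   map_comp := map_comp } : MultiCat.{u} ⥤ GvNHCat.{u}) ⊣ gvnhProperty.{u}.ι,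
          ∀ A : MultiCat.{u}, adj.unit.app A = toVHull A.carrier := by
  refine ⟨fun A _ _ => inferInstance, fun A _ _ => VHull.isGvNH, ?_, ?_, ?_⟩
  · intro A B _ _ _ _ f
    exact ⟨hullMap f, hullMap_comp_toVHull f,
      fun g hg => hull_hom_ext (hg.trans (hullMap_comp_toVHull f).symm)⟩
  · intro A B _ _ _ _ f hB
    exact ⟨hullLift hB f, hullLift_comp_toVHull hB f,
      fun g hg => hull_hom_ext_of_isGvNH hB (hg.trans (hullLift_comp_toVHull hB f).symm)⟩
  · refine ⟨fun {A B} f => ObjectProperty.homMk (hullMap (A := A.carrier) (B := B.carrier) f),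
      fun A => ObjectProperty.hom_ext _ ?_, fun {A B C} f g => ObjectProperty.hom_ext _ ?_,
      fun A B f => hullMap_comp_toVHull f, ?_⟩
    · exact hull_hom_ext (A := A.carrier) (B := A.carrier)
        (hullMap_comp_toVHull (MultiringHom.id A.carrier))
    · refine hull_hom_ext (A := A.carrier) (B := C.carrier)
        ((hullMap_comp_toVHull (MultiringHom.comp g f)).trans ?_)
      refine Eq.trans ?_ (congrArg (MultiringHom.comp (hullMap g)) (hullMap_comp_toVHull f).symm)
      exact congrArg (fun h : MultiringHom B.carrier (VHull C.carrier) => MultiringHom.comp h f)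
        (hullMap_comp_toVHull g).symm
    -- The bijection of Hom-sets is restriction along `v_A`, with inverse `hullLift`; hence the unit
    -- is `v`, and naturality follows from uniqueness of extensions.
    · refine ⟨Adjunction.mkOfHomEquiv
        { homEquiv := fun A B =>
            { toFun := fun g => MultiringHom.comp g.hom (toVHull A.carrier)
              invFun := fun f => ObjectProperty.homMk
                (hullLift (A := A.carrier) (B := B.obj.carrier) B.property f)
              left_inv := fun g => ObjectProperty.hom_ext _
                (hull_hom_ext_of_isGvNH (A := A.carrier) (B := B.obj.carrier) B.property
                  (hullLift_comp_toVHull _ _))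
              right_inv := fun f => hullLift_comp_toVHull _ _ }
          homEquiv_naturality_left_symm := ?_
          homEquiv_naturality_right := fun f g => rfl }, fun A => rfl⟩
      intro A A' B f g
      refine ObjectProperty.hom_ext _ (hull_hom_ext_of_isGvNH (A := A.carrier)
        (B := B.obj.carrier) B.property ((hullLift_comp_toVHull _ _).trans ?_))
      refine Eq.trans ?_ (congrArg (MultiringHom.comp (hullLift (A := A'.carrier)
        (B := B.obj.carrier) B.property g)) (hullMap_comp_toVHull f).symm)
      exact congrArg (fun h : MultiringHom A'.carrier B.obj.carrier => MultiringHom.comp h f)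
        (hullLift_comp_toVHull (A := A'.carrier) (B := B.obj.carrier) B.property g).symm
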